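/- Theorem 1.4. Let $M$ be a real $2\times 2$ matrix whose eigenvalues are all less than $1$ in modulus, let $u\in\mathbb R^2$, and consider the maps $T_m(v)=Mv-u$ and $T_p(v)=Mv+u$ of $\mathbb R^2$. Let $A$ be the attractor of this iterated function system (IFS), that is, the unique non-empty compact set with $A=T_m(A)\cup T_p(A)$. An address of a point $z\in A$ is a sequence $a_0a_1a_2\dots\in\{m,p\}^{\mathbb N}$ with $z=\lim_{n\to\infty}T_{a_0}\circ T_{a_1}\circ\dots\circ T_{a_n}(0)$, and $\mathcal U$ denotes the set of points of $A$ that have exactly one address. Assume that the IFS is non-degenerate: $0$ is not an eigenvalue of $M$, and $u$ is a cyclic vector for $M$, i.e. the span of $\{M^nu : n\ge 0\}$ is $\mathbb R^2$. Let $\beta_*=1.787231650\dots$ be the Komornik–Loreti constant, i.e. the unique $x>1$ with $\sum_{n\ge 1}t_nx^{-n}=1$, where $t_0t_1t_2\dots=0110\,1001\,1001\,0110\dots$ is the Thue–Morse sequence. Suppose that neither of the following two exceptional cases occurs: (a) $M$ has a non-real eigenvalue $\kappa=\rho\, e^{2\pi i p/q}$ with $\rho>0$, $p\in\mathbb Z$,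 $q\ge1$, $\gcd(p,q)=1$, and $\rho^{-q'}\le\beta_*$, where $q'=q$ if $q$ is odd and $q'=q/2$ if $q$ is even; (b) the eigenvalues of $M$ are $\lambda$ and $-\lambda$ for some real $\lambda>0$, and $\lambda^{-2}\le\beta_*$. Then $\mathcal U$ is uncountable and has positive Hausdorff dimension. -/

import Mathlib

open Filter Topology

namespace PlanarIFS

/-- The Euclidean plane. -/
abbrev Plane : Type := EuclideanSpace ℝ (Fin 2)

/-- The two affine maps `v ↦ M v + u` (digit `true`, the map `T_p`) and
`v ↦ M v - u` (digit `false`, the map `T_m`). -/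
noncomputable def T (M : Matrix (Fin 2) (Fin 2) ℝ) (u : Plane) (d : Bool) (v : Plane) : Plane :=
  Matrix.toEuclideanLin M v + (if d then u else -u)

/-- `prefixMap M u a n = T_{a 0} ∘ T_{a 1} ∘ ⋯ ∘ T_{a (n-1)}`. -/
noncomputable def prefixMap (M : Matrix (Fin 2) (Fin 2) ℝ) (u : Plane) (a : ℕ → Bool) :
    ℕ → Plane → Plane
  | 0 => id
  | n + 1 => prefixMap M u a n ∘ T M u (a n)

/-- The sequence `a` is an address of `z`: the points `T_{a 0} ∘ ⋯ ∘ T_{a n} (0)` converge to `z`. -/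
def IsAddress (M : Matrix (Fin 2) (Fin 2) ℝ) (u : Plane) (a : ℕ → Bool) (z : Plane) : Prop :=
  Tendsto (fun n : ℕ => prefixMap M u a (n + 1) 0) atTop (𝓝 z)

/-- `A` is the attractor of the iterated function system `{T_m, T_p}`. -/
def IsAttractor (M : Matrix (Fin 2) (Fin 2) ℝ) (u : Plane) (A : Set Plane) : Prop :=
  A.Nonempty ∧ IsCompact A ∧ A = T M u false '' A ∪ T M u true '' A

/-- The set of uniqueness: the points of `A` that have exactly one address. -/
def uniquenessSet (M : Matrix (Fin 2) (Fin 2) ℝ) (u : Plane) (A : Set Plane) : Set Plane :=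
  {z | z ∈ A ∧ ∃! a : ℕ → Bool, IsAddress M u a z}

/-- The complex eigenvalues of the real matrix `M`. -/
def eigenvalues (M : Matrix (Fin 2) (Fin 2) ℝ) : Set ℂ :=
  spectrum ℂ (M.map (algebraMap ℝ ℂ))

/-- The IFS is non-degenerate: `0` is not an eigenvalue of `M`, and `u` is a cyclic vector for `M`,
that is, `u` lies in no proper `M`-invariant subspace of the plane. -/
def NonDegenerate (M : Matrix (Fin 2) (Fin 2) ℝ) (u : Plane) : Prop :=
  (0 : ℂ) ∉ eigenvalues M ∧
    Submodule.span ℝ (Set.range fun n : ℕ => Matrix.toEuclideanLin (M ^ n) u) = ⊤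

/-- The Thue–Morse sequence `0110 1001 1001 0110 …`, indexed from `0`: the parity of the sum of
the binary digits of `n`. -/
def thueMorse (n : ℕ) : ℕ := (Nat.digits 2 n).sum % 2

/-- The Thue–Morse sequence is fixed by the substitution `0 ↦ 01`, `1 ↦ 10`. -/
theorem thueMorse_substitution :
    thueMorse 0 = 0 ∧ ∀ n : ℕ, thueMorse (2 * n) = thueMorse n ∧
      thueMorse (2 * n + 1) = 1 - thueMorse n := by
  refine ⟨by simp [thueMorse], fun n => ⟨?_, ?_⟩⟩
  · rcases Nat.eq_zero_or_pos n with rfl | h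
    · simp
    · have := Nat.digits_add_two_add_one 0 (2 * n - 1)
      rw [show 2 * n - 1 + 1 = 2 * n by omega] at this
      simp [thueMorse, this]
  · have := Nat.digits_add_two_add_one 0 (2 * n)
    simp only [thueMorse, zero_add] at this ⊢
    rw [this, show (2 * n + 1) / 2 = n by omega, show (2 * n + 1) % 2 = 1 by omega]
    simp only [List.sum_cons]
    omega

/-- The Komornik–Loreti constant `β_* = 1.787231650…`: the solution `x > 1` of
`∑_{n ≥ 1} t_n x^{-n} = 1`, where `t_0 t_1 t_2 … = 0110 1001 …` is the Thue–Morse sequence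
(the term for `n = 0` vanishes). There is exactly one, see `komornikLoreti_spec`. -/
noncomputable def komornikLoreti : ℝ :=
  sInf {x : ℝ | 1 < x ∧ HasSum (fun n : ℕ => (thueMorse n : ℝ) * x⁻¹ ^ n) 1}

theorem thueMorse_le_one (n : ℕ) : (thueMorse n : ℝ) ≤ 1 := by
  have : thueMorse n ≤ 1 := by unfold thueMorse; omega
  exact_mod_cast this

theorem summable_thueMorse {x : ℝ} (hx : 1 < x) :
    Summable fun n : ℕ => (thueMorse n : ℝ) * x⁻¹ ^ n := by
  have h0 : 0 < x⁻¹ := by positivity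
  refine Summable.of_nonneg_of_le (fun n => by positivity) (fun n => ?_)
    (summable_geometric_of_lt_one h0.le (inv_lt_one_of_one_lt₀ hx))
  have := thueMorse_le_one n
  have h1 : 0 < x⁻¹ ^ n := by positivity
  nlinarith

theorem existsUnique_komornikLoreti :
    ∃! x : ℝ, 1 < x ∧ HasSum (fun n : ℕ => (thueMorse n : ℝ) * x⁻¹ ^ n) 1 := by
  have t0 : thueMorse 0 = 0 := by simp [thueMorse]
  have t1 : thueMorse 1 = 1 := by simp [thueMorse]
  have t2 : thueMorse 2 = 1 := by simp [thueMorse]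
  have anti : ∀ x y : ℝ, 1 < x → x < y →
      ∑' n : ℕ, (thueMorse n : ℝ) * y⁻¹ ^ n < ∑' n : ℕ, (thueMorse n : ℝ) * x⁻¹ ^ n := by
    intro x y hx hxy
    have hi : y⁻¹ < x⁻¹ := inv_strictAnti₀ (by linarith) hxy
    have hy0 : 0 < y⁻¹ := inv_pos.2 (by linarith)
    refine Summable.tsum_lt_tsum (i := 1) (fun n => ?_) ?_
      (summable_thueMorse (hx.trans hxy)) (summable_thueMorse hx)
    · gcongr
    · simpa [t1] using hi
  have cont : ContinuousOn (fun x : ℝ => ∑' n : ℕ, (thueMorse n : ℝ) * x⁻¹ ^ n)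
      (Set.Icc (3 / 2) 2) := by
    refine continuousOn_tsum (u := fun n : ℕ => (2 / 3 : ℝ) ^ n) (fun n => ?_)
      (summable_geometric_of_lt_one (by norm_num) (by norm_num)) (fun n x hx => ?_)
    · refine continuousOn_const.mul (ContinuousOn.pow (ContinuousOn.inv₀ continuousOn_id ?_) n)
      intro x hx
      have := hx.1
      simp only [id]
      linarith
    · have hx0 : 0 < x := by linarith [hx.1]
      have h1 : x⁻¹ ≤ 2 / 3 := by
        rw [inv_le_comm₀ hx0 (by norm_num)]; norm_num; linarith [hx.1]
      have h2 : x⁻¹ ^ n ≤ (2 / 3 : ℝ) ^ n := by gcongr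
      have h3 : 0 ≤ x⁻¹ ^ n := by positivity
      have h4 := thueMorse_le_one n
      rw [Real.norm_of_nonneg (by positivity)]
      nlinarith
  have hlow : 1 ≤ ∑' n : ℕ, (thueMorse n : ℝ) * (3 / 2 : ℝ)⁻¹ ^ n := by
    have := (summable_thueMorse (x := 3 / 2) (by norm_num)).sum_le_tsum (Finset.range 3)
      (fun n _ => by positivity)
    simp only [Finset.sum_range_succ, Finset.sum_range_zero, t0, t1, t2] at this
    norm_num at this ⊢
    linarith
  have hhigh : ∑' n : ℕ, (thueMorse n : ℝ) * (2 : ℝ)⁻¹ ^ n ≤ 1 := by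
    have hs := summable_thueMorse (x := 2) (by norm_num)
    have hg : Summable fun n : ℕ => (2 : ℝ)⁻¹ ^ n :=
      summable_geometric_of_lt_one (by norm_num) (by norm_num)
    rw [hs.tsum_eq_zero_add, t0]
    have h1 : ∑' n : ℕ, (thueMorse (n + 1) : ℝ) * (2 : ℝ)⁻¹ ^ (n + 1) ≤
        ∑' n : ℕ, (2 : ℝ)⁻¹ ^ (n + 1) := by
      refine Summable.tsum_le_tsum (fun n => ?_) ((summable_nat_add_iff 1).2 hs)
        ((summable_nat_add_iff 1).2 hg)
      have h3 : (0 : ℝ) ≤ (2 : ℝ)⁻¹ ^ (n + 1) := by positivity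
      have h4 := thueMorse_le_one (n + 1)
      nlinarith
    have h2 : ∑' n : ℕ, (2 : ℝ)⁻¹ ^ (n + 1) = 1 := by
      simp only [pow_succ]
      rw [tsum_mul_right, tsum_geometric_of_lt_one (by norm_num) (by norm_num)]
      norm_num
    simp only [Nat.cast_zero, zero_mul, zero_add]
    linarith
  obtain ⟨x, hx, hx1⟩ := intermediate_value_Icc' (by norm_num) cont ⟨hhigh, hlow⟩
  have hx' : 1 < x := by linarith [hx.1]
  refine ⟨x, ⟨hx', ?_⟩, ?_⟩
  · have := (summable_thueMorse hx').hasSum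
    simp only at hx1
    rwa [hx1] at this
  · rintro y ⟨hy, hys⟩
    simp only at hx1
    rcases lt_trichotomy y x with h | h | h
    · have := anti y x hy h
      rw [hys.tsum_eq, hx1] at this
      exact absurd this (lt_irrefl _)
    · exact h
    · have := anti x y hx' h
      rw [hys.tsum_eq, hx1] at this
      exact absurd this (lt_irrefl _)

theorem komornikLoreti_spec :
    1 < komornikLoreti ∧
      HasSum (fun n : ℕ => (thueMorse n : ℝ) * komornikLoreti⁻¹ ^ n) 1 ∧
      ∀ x : ℝ, 1 < x → HasSum (fun n : ℕ => (thueMorse n : ℝ) * x⁻¹ ^ n) 1 →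
        x = komornikLoreti := by
  obtain ⟨x, hx, hu⟩ := existsUnique_komornikLoreti
  have hset : {x : ℝ | 1 < x ∧ HasSum (fun n : ℕ => (thueMorse n : ℝ) * x⁻¹ ^ n) 1} = {x} :=
    Set.eq_singleton_iff_unique_mem.2 ⟨hx, hu⟩
  have hk : komornikLoreti = x := by
    unfold komornikLoreti
    rw [hset, csInf_singleton]
  rw [hk]
  exact ⟨hx.1, hx.2, fun y h1 h2 => hu y ⟨h1, h2⟩⟩

/-- The exceptional complex case: `M` has a non-real eigenvalue `κ = ρ e^{2πip/q}` with
`gcd(p, q) = 1`, and `β = ρ^{-q'}` satisfies `β ≤ β_*`, where `q' = q` for odd `q` and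
`q' = q / 2` for even `q`. -/
def ExceptionalRotation (M : Matrix (Fin 2) (Fin 2) ℝ) : Prop :=
  ∃ (κ : ℂ) (ρ : ℝ) (p : ℤ) (q : ℕ), κ ∈ eigenvalues M ∧ κ.im ≠ 0 ∧ 0 < ρ ∧ 0 < q ∧
    IsCoprime p (q : ℤ) ∧
    κ = (ρ : ℂ) * Complex.exp (2 * (Real.pi : ℂ) * Complex.I * (p : ℂ) / (q : ℂ)) ∧
    (ρ ^ (if Odd q then q else q / 2))⁻¹ ≤ komornikLoreti

/-- The exceptional real case: the eigenvalues of `M` are `r` and `-r` with `r > 0`, and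
`β = r^{-2}` satisfies `β ≤ β_*`. -/
def ExceptionalReflection (M : Matrix (Fin 2) (Fin 2) ℝ) : Prop :=
  ∃ r : ℝ, 0 < r ∧ (r : ℂ) ∈ eigenvalues M ∧ (-(r : ℂ)) ∈ eigenvalues M ∧
    (r ^ 2)⁻¹ ≤ komornikLoreti

end PlanarIFS

namespace PlanarIFS

/-! Addresses of points of $A$ are signed series $\sum\pm f^n u$, where $f$ is the linear map of
$M$. Two addresses of one point give a relation $\sum e_n f^n u=0$ with $e_n\in\{0,\pm2\}$, so the
task is to find many sign sequences whose first symbol admits no such relation with $e_0\ne0$.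

`dimH_uniqueCodings_pos` reduces this to symbolic dynamics. If $K$ is closed, shift invariant and
every member has a unique first symbol, then by compactness the uniqueness is uniform and depends
only on a window of some length $N$. Two distinct words whose concatenations look like members of
$K$ in every window of length $N$ then produce a Cantor set of unique codings, separated at a
geometric rate, hence of positive dimension. Uncountability follows, since countable sets have
dimension zero.

The set $K$ depends on the eigenvalues. * Real eigenvalues, non-zero trace: up to $f\mapsto-f$ there
is a positive dominating eigenvalue, and sequences with at most one minus sign serve
(`dimH_uniqueCodings_pos_of_dominating`). * Otherwise $K$ consists of sequences that follow the
signs of $\varphi(f^n u)$ for a functional $\varphi\ne0$. They code points of $A$ on a supporting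
line, and only indices with $\varphi(f^nu)=0$ leave freedom. If the orbit of $u$ never returns to
the line of $u$, there is at most one such index, and recurrence of the rotation supplies the words
(`dimH_uniqueCodings_pos_of_recurrent`). * If some power $f^Q$ is a homothety of ratio $\tau$, the
free indices form a progression of difference $Q$, and a one-dimensional expansion problem in base
$1/|\tau|$ remains. Thue–Morse signs solve it exactly when the base exceeds $\beta_*$ in the sense
needed here: the relevant series then stays below $1$ (`dimH_uniqueCodings_pos_of_pow_eq_smul`). -/

/-- The digit `±1` attached to a symbol. -/
def digit (b : Bool) : ℝ := if b then 1 else -1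

@[simp] theorem digit_true : digit true = 1 := rfl

@[simp] theorem digit_false : digit false = -1 := rfl

@[simp] theorem digit_not (b : Bool) : digit (!b) = -digit b := by cases b <;> simp

theorem abs_digit (b : Bool) : |digit b| = 1 := by cases b <;> simp

theorem digit_mul_self (b : Bool) : digit b * digit b = 1 := by cases b <;> simp

theorem continuous_digit_apply (n : ℕ) : Continuous fun a : ℕ → Bool => digit (a n) :=
  (continuous_of_discreteTopology (f := digit)).comp (continuous_apply n)

/-! ### Signed power series and uniform separation of codings -/

section Coding

variable {E : Type*} [NormedAddCommGroup E] [NormedSpace ℝ E]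

/-- The point `∑ ± f ^ n u` with signs given by the sequence `a`. -/
noncomputable def coding (f : E →L[ℝ] E) (u : E) (a : ℕ → Bool) : E :=
  ∑' n, digit (a n) • (f ^ n) u

/-- The points that are coded by exactly one sequence. -/
def uniqueCodings (f : E →L[ℝ] E) (u : E) : Set E :=
  {z | ∃ a, coding f u a = z ∧ ∀ c, coding f u c = z → c = a}

theorem norm_digit_smul (b : Bool) (v : E) : ‖digit b • v‖ = ‖v‖ := by
  rw [norm_smul, Real.norm_eq_abs, abs_digit, one_mul]

variable [CompleteSpace E] {f : E →L[ℝ] E} {u : E}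

theorem summable_coding (hs : Summable fun n => ‖(f ^ n) u‖) (a : ℕ → Bool) :
    Summable fun n => digit (a n) • (f ^ n) u :=
  Summable.of_norm (by simpa only [norm_digit_smul] using hs)

theorem continuous_coding (hs : Summable fun n => ‖(f ^ n) u‖) : Continuous (coding f u) :=
  continuous_tsum (fun n => (continuous_digit_apply n).smul continuous_const) hs
    (fun n a => (norm_digit_smul (a n) _).le)

theorem coding_eq_sum_add (hs : Summable fun n => ‖(f ^ n) u‖) (a : ℕ → Bool) (k : ℕ) :
    coding f u a = ∑ n ∈ Finset.range k, digit (a n) • (f ^ n) u +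
      (f ^ k) (coding f u fun n => a (n + k)) := by
  rw [coding, ← (summable_coding hs a).sum_add_tsum_nat_add k, coding,
    (f ^ k).map_tsum (summable_coding hs _)]
  congr 1
  refine tsum_congr fun n => ?_
  rw [map_smul, add_comm n k, pow_add, mul_apply_eq_comp]

theorem coding_sub_of_agree (hs : Summable fun n => ‖(f ^ n) u‖) {a b : ℕ → Bool} {k : ℕ}
    (h : ∀ i < k, a i = b i) : coding f u a - coding f u b =
      (f ^ k) ((coding f u fun n => a (n + k)) - coding f u fun n => b (n + k)) := by
  rw [coding_eq_sum_add hs a k, coding_eq_sum_add hs b k, map_sub,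
    Finset.sum_congr rfl fun i hi => by rw [h i (Finset.mem_range.1 hi)]]
  abel

/-- Sequences agreeing on a long prefix code nearby points. -/
theorem exists_agree_norm_coding_sub_le (hs : Summable fun n => ‖(f ^ n) u‖) {ε : ℝ} (hε : 0 < ε) :
    ∃ N, ∀ a b : ℕ → Bool, (∀ i < N, a i = b i) → ‖coding f u a - coding f u b‖ ≤ ε := by
  have ht := tendsto_sum_nat_add fun n => ‖(f ^ n) u‖
  obtain ⟨N, hN⟩ := (ht.eventually (gt_mem_nhds (half_pos hε))).exists
  refine ⟨N, fun a b hab => ?_⟩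
  have key : ∀ c : ℕ → Bool, ‖∑' n, digit (c (n + N)) • (f ^ (n + N)) u‖ ≤ ε / 2 := fun c => by
    refine le_trans (tsum_of_norm_bounded ((summable_nat_add_iff N).2 hs).hasSum fun n => ?_) hN.le
    exact (norm_digit_smul _ _).le
  rw [coding, coding, ← (summable_coding hs a).sum_add_tsum_nat_add N,
    ← (summable_coding hs b).sum_add_tsum_nat_add N,
    Finset.sum_congr rfl fun i hi => by rw [hab i (Finset.mem_range.1 hi)], add_sub_add_left_eq_sub]
  exact (norm_sub_le _ _).trans (by linarith [key a, key b])

/-- Uniqueness of the first symbol for all members of a closed set of sequences is uniform, and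
extends to all sequences that share a long prefix with a member. -/
theorem exists_uniform_separation (hs : Summable fun n => ‖(f ^ n) u‖) {K : Set (ℕ → Bool)}
    (hK : IsClosed K) (huniq : ∀ a ∈ K, ∀ c, c 0 ≠ a 0 → coding f u c ≠ coding f u a) :
    ∃ δ > 0, ∃ N, ∀ b c, (∃ a ∈ K, ∀ i < N, a i = b i) → c 0 ≠ b 0 →
      δ ≤ ‖coding f u b - coding f u c‖ := by
  have hc := continuous_coding hs
  have hcl : IsClosed {p : (ℕ → Bool) × (ℕ → Bool) | p.1 ∈ K ∧ p.2 0 ≠ p.1 0} := by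
    refine (hK.preimage continuous_fst).inter ?_
    have : Continuous fun p : (ℕ → Bool) × (ℕ → Bool) => (p.2 0, p.1 0) := by fun_prop
    exact (isClosed_discrete {q : Bool × Bool | q.1 ≠ q.2}).preimage this
  -- The differences of codings with distinct first symbols, the first sequence lying in `K`, form a
  -- compact set that misses $0$, hence also a ball around $0$.
  have him := (hcl.isCompact.image
    (f := fun p => coding f u p.1 - coding f u p.2) (by fun_prop)).isClosed.isOpen_compl
  have h0 : (0 : E) ∈ ((fun p : (ℕ → Bool) × (ℕ → Bool) => coding f u p.1 - coding f u p.2) ''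
      {p | p.1 ∈ K ∧ p.2 0 ≠ p.1 0})ᶜ := by
    rintro ⟨p, ⟨hp, hp'⟩, h⟩
    exact huniq _ hp _ hp' (sub_eq_zero.1 h).symm
  obtain ⟨ε, hε, hball⟩ := Metric.isOpen_iff.1 him 0 h0
  obtain ⟨N, hN⟩ := exists_agree_norm_coding_sub_le hs (half_pos hε)
  -- Length `N + 1` rather than `N` guarantees agreement at index $0$.
  refine ⟨ε / 2, half_pos hε, N + 1, fun b c ⟨a, ha, hab⟩ hcb => ?_⟩
  have h1 : ε ≤ ‖coding f u a - coding f u c‖ := by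
    by_contra! hlt
    refine hball (a := coding f u a - coding f u c) (by simpa using hlt) ⟨(a, c), ⟨ha, ?_⟩, rfl⟩
    simpa [hab 0 (by omega)] using hcb
  have h2 := hN a b fun i hi => hab i (by omega)
  have h3 := norm_add_le (coding f u a - coding f u b) (coding f u b - coding f u c)
  rw [sub_add_sub_cancel] at h3
  linarith

/-- The concatenation of the words `W (x 0)`, `W (x 1)`, …, each of length `L`. -/
def concat (W : Bool → ℕ → Bool) (L : ℕ) (x : ℕ → Bool) (n : ℕ) : Bool := W (x (n / L)) (n % L)

theorem concat_apply_mul_add (W : Bool → ℕ → Bool) {L : ℕ} (x : ℕ → Bool) (i : ℕ) {r : ℕ}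
    (hr : r < L) : concat W L x (L * i + r) = W (x i) r := by
  rw [concat, Nat.mul_add_div (by omega), Nat.div_eq_of_lt hr, Nat.mul_add_mod, Nat.mod_eq_of_lt hr,
    add_zero]

theorem add_mem_of_shift_mem {K : Set (ℕ → Bool)} (hshift : ∀ a ∈ K, (fun n => a (n + 1)) ∈ K)
    (k : ℕ) {a : ℕ → Bool} (ha : a ∈ K) : (fun n => a (n + k)) ∈ K := by
  induction k with
  | zero => exact ha
  | succ k ih => simpa only [add_assoc, add_comm 1 k] using hshift _ ih

/-- The windows of length `N` of a concatenation occur in a shift invariant set as soon as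
the words formed by a block and the beginning of the next one do. -/
theorem exists_mem_agree_concat {K : Set (ℕ → Bool)}
    (hshift : ∀ a ∈ K, (fun n => a (n + 1)) ∈ K) {W : Bool → ℕ → Bool} {L N : ℕ} (hL : 0 < L)
    (hNL : N ≤ L) (hW : ∀ b b', ∃ a ∈ K, ∀ i < L + N, a i = if i < L then W b i else W b' (i - L))
    (x : ℕ → Bool) (n : ℕ) : ∃ a ∈ K, ∀ i < N, a i = concat W L x (i + n) := by
  obtain ⟨a, ha, hab⟩ := hW (x (n / L)) (x (n / L + 1))
  refine ⟨_, add_mem_of_shift_mem hshift (n % L) ha, fun i hi => ?_⟩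
  have hr := Nat.mod_lt n hL
  have hn := Nat.div_add_mod n L
  rw [hab _ (by omega)]
  split_ifs with h
  · rw [show i + n = L * (n / L) + (i + n % L) by omega, concat_apply_mul_add _ _ _ h]
  · rw [show i + n = L * (n / L + 1) + (i + n % L - L) by rw [mul_add]; omega,
      concat_apply_mul_add _ _ _ (by omega)]


end Coding

/-! ### Positive Hausdorff dimension from separation -/

section

/-- A map from the Cantor space that separates sequences at least geometrically in the position of
their first disagreement has a range of positive Hausdorff dimension. -/
theorem dimH_range_pos_of_separated {X : Type*} [MetricSpace X] (Φ : (ℕ → Bool) → X) {c q : ℝ}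
    (hc : 0 < c) (hq : 0 < q) (hq1 : q < 1)
    (hsep : ∀ x y i, (∀ j < i, x j = y j) → x i ≠ y i → c * q ^ i ≤ dist (Φ x) (Φ y)) :
    0 < dimH (Set.range Φ) := by
  have first : ∀ x y : ℕ → Bool, x ≠ y → ∃ i, (∀ j < i, x j = y j) ∧ x i ≠ y i := by
    intro x y hxy
    classical
    have h : ∃ i, x i ≠ y i := Function.ne_iff.1 hxy
    exact ⟨Nat.find h, fun j hj => not_not.1 (Nat.find_min h hj), Nat.find_spec h⟩
  have hinj : Function.Injective Φ := by
    intro x y hxy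
    by_contra hne
    obtain ⟨i, hi, hi'⟩ := first x y hne
    have h1 := hsep x y i hi hi'
    rw [hxy, dist_self] at h1
    have : 0 < c * q ^ i := by positivity
    linarith
  -- Reading the sequence as a binary expansion maps the range onto $[0,1]$. The exponent `α` is
  -- chosen with $q^\alpha=1/2$, which makes this map Hölder, so the range cannot have dimension
  -- zero.
  set val : (ℕ → Bool) → ℝ := fun x => Real.ofDigits fun n => finTwoEquiv.symm (x n) with hval
  set F : X → ℝ := fun z => val (Function.invFun Φ z) with hF
  have hFΦ : ∀ x, F (Φ x) = val x := fun x => by rw [hF]; simp [Function.leftInverse_invFun hinj x]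
  set α : ℝ := Real.log (1 / 2) / Real.log q with hα
  have hlog : Real.log q < 0 := Real.log_neg hq hq1
  have hα0 : 0 < α := div_pos_of_neg_of_neg (Real.log_neg (by norm_num) (by norm_num)) hlog
  have hqα : q ^ α = 1 / 2 := by
    rw [Real.rpow_def_of_pos hq, hα, mul_div_cancel₀ _ hlog.ne, Real.exp_log (by norm_num)]
  have hbound : ∀ x y, dist (F (Φ x)) (F (Φ y)) ≤ c⁻¹ ^ α * dist (Φ x) (Φ y) ^ α := by
    intro x y
    rcases eq_or_ne x y with rfl | hne
    · simp only [dist_self]; positivity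
    obtain ⟨i, hi, hi'⟩ := first x y hne
    rw [hFΦ, hFΦ, Real.dist_eq]
    calc |val x - val y| ≤ (((2 : ℕ) : ℝ) ^ i)⁻¹ :=
          Real.abs_ofDigits_sub_ofDigits_le fun j hj => by rw [hi j hj]
      _ = (q ^ i) ^ α := by
          rw [← Real.rpow_natCast q, ← Real.rpow_mul hq.le, mul_comm, Real.rpow_mul hq.le, hqα,
            Real.rpow_natCast]
          simp
      _ ≤ (c⁻¹ * dist (Φ x) (Φ y)) ^ α := by
          refine Real.rpow_le_rpow (by positivity) ?_ hα0.le
          rw [← div_eq_inv_mul, le_div_iff₀' hc]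
          exact hsep x y i hi hi'
      _ = _ := Real.mul_rpow (by positivity) dist_nonneg
  have hold : HolderOnWith (c⁻¹ ^ α).toNNReal α.toNNReal F (Set.range Φ) := by
    rintro _ ⟨x, rfl⟩ _ ⟨y, rfl⟩
    rw [edist_dist, edist_dist, Real.coe_toNNReal _ hα0.le,
      ENNReal.ofReal_rpow_of_nonneg dist_nonneg hα0.le]
    change _ ≤ ENNReal.ofReal _ * _
    rw [← ENNReal.ofReal_mul (by positivity)]
    exact ENNReal.ofReal_le_ofReal (hbound x y)
  have hsub : Set.Icc (0 : ℝ) 1 ⊆ F '' Set.range Φ := by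
    intro t ht
    obtain ⟨d, -, hd⟩ := Real.ofDigits_SurjOn (b := 2) (by norm_num) ht
    refine ⟨_, ⟨fun n => finTwoEquiv (d n), rfl⟩, ?_⟩
    rw [hFΦ, hval]
    simpa using hd
  have h1 : dimH (Set.Icc (0 : ℝ) 1) = 1 := by
    rw [Real.dimH_of_nonempty_interior (by rw [interior_Icc]; exact ⟨1 / 2, by norm_num⟩)]
    simp
  have hle := hold.dimH_image_le (Real.toNNReal_pos.2 hα0)
  rw [pos_iff_ne_zero]
  intro h0
  rw [h0, ENNReal.zero_div] at hle
  have := (dimH_mono hsub).trans hle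
  rw [h1] at this
  exact absurd this (by norm_num)

variable {E : Type*} [NormedAddCommGroup E] [NormedSpace ℝ E] [CompleteSpace E]
  {f : E →L[ℝ] E} {u : E}

/-- The criterion for positive dimension: a closed shift invariant set `K` of sequences, each of
which has a unique first symbol, whose language contains for every `N` two words that can be freely
concatenated up to windows of length `N`. -/
theorem dimH_uniqueCodings_pos (hs : Summable fun n => ‖(f ^ n) u‖) {κ : ℝ} (hκ : 0 < κ)
    (hfκ : ∀ v, κ * ‖v‖ ≤ ‖f v‖) {K : Set (ℕ → Bool)} (hK : IsClosed K)
    (hshift : ∀ a ∈ K, (fun n => a (n + 1)) ∈ K)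
    (huniq : ∀ a ∈ K, ∀ c, c 0 ≠ a 0 → coding f u c ≠ coding f u a)
    (hwords : ∀ N, ∃ L, 0 < L ∧ N ≤ L ∧ ∃ W : Bool → ℕ → Bool,
      (∃ r < L, W true r ≠ W false r) ∧
      ∀ b b', ∃ a ∈ K, ∀ i < L + N, a i = if i < L then W b i else W b' (i - L)) :
    0 < dimH (uniqueCodings f u) := by
  classical
  obtain ⟨δ, hδ, N, hsepN⟩ := exists_uniform_separation hs hK huniq
  obtain ⟨L, hL, hNL, W, ⟨r, hrL, hr⟩, hW⟩ := hwords N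
  have hwin := exists_mem_agree_concat hshift hL hNL hW
  have hpow : ∀ n v, κ ^ n * ‖v‖ ≤ ‖(f ^ n) v‖ := by
    intro n
    induction n with
    | zero => intro v; simp
    | succ n ih =>
      intro v
      rw [pow_succ, pow_succ, mul_apply_eq_comp]
      have := mul_le_mul_of_nonneg_left (hfκ v) (pow_nonneg hκ.le n)
      linarith [ih (f v)]
  -- Here `c` is arbitrary, not only a concatenation, so the estimate yields both uniqueness of the
  -- coding and separation of the Cantor set.
  have hsep : ∀ x (c : ℕ → Bool) n, (∀ i < n, concat W L x i = c i) → concat W L x n ≠ c n →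
      κ ^ n * δ ≤ ‖coding f u (concat W L x) - coding f u c‖ := by
    intro x c n h hne
    rw [coding_sub_of_agree hs h]
    refine le_trans ?_ (hpow n _)
    refine mul_le_mul_of_nonneg_left (hsepN _ _ (hwin x n) ?_) (pow_nonneg hκ.le n)
    simpa using hne.symm
  have hsub : Set.range (fun x => coding f u (concat W L x)) ⊆ uniqueCodings f u := by
    rintro _ ⟨x, rfl⟩
    refine ⟨_, rfl, fun c hc => ?_⟩
    by_contra hne
    have hex : ∃ i, concat W L x i ≠ c i := Function.ne_iff.1 (Ne.symm hne)
    have := hsep x c (Nat.find hex) (fun j hj => not_not.1 (Nat.find_min hex hj))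
      (Nat.find_spec hex)
    rw [hc, sub_self, norm_zero] at this
    have : 0 < κ ^ Nat.find hex * δ := by positivity
    linarith
  refine lt_of_lt_of_le ?_ (dimH_mono hsub)
  -- A ratio below $1$ is needed because the first disagreement of the concatenations is only known
  -- to lie before $L(i+1)$.
  set κ' := min κ (1 / 2) with hκ'
  have hκ0 : 0 < κ' := lt_min hκ (by norm_num)
  have hκ1 : κ' < 1 := (min_le_right _ _).trans_lt (by norm_num)
  refine dimH_range_pos_of_separated _ (c := κ' ^ L * δ) (q := κ' ^ L) (by positivity)
    (by positivity) (pow_lt_one₀ hκ0.le hκ1 hL.ne') fun x y i hi hne => ?_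
  have hdiff : concat W L x (L * i + r) ≠ concat W L y (L * i + r) := by
    rw [concat_apply_mul_add _ _ _ hrL, concat_apply_mul_add _ _ _ hrL]
    revert hne
    cases x i <;> cases y i <;> simp_all [eq_comm]
  have hex : ∃ n, concat W L x n ≠ concat W L y n := ⟨_, hdiff⟩
  have hle := Nat.find_min' hex hdiff
  have h1 := hsep x _ (Nat.find hex) (fun j hj => not_not.1 (Nat.find_min hex hj))
    (Nat.find_spec hex)
  rw [dist_eq_norm]
  refine le_trans ?_ h1
  calc κ' ^ L * δ * (κ' ^ L) ^ i = κ' ^ (L * i + L) * δ := by rw [pow_add, pow_mul]; ring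
    _ ≤ κ' ^ Nat.find hex * δ := by
        gcongr ?_ * _
        exact pow_le_pow_of_le_one hκ0.le hκ1.le (by omega)
    _ ≤ κ ^ Nat.find hex * δ := by gcongr; exact min_le_left _ _

end

/-! ### A dominating real eigenvalue -/

section

variable {E : Type*} [NormedAddCommGroup E] [NormedSpace ℝ E]

theorem digit_sub_nonneg {a c : Bool} (ha : a = true) : 0 ≤ digit a - digit c := by
  subst ha; cases c <;> norm_num

theorem digit_mul_digit_sub_nonneg (a c : Bool) : 0 ≤ digit a * (digit a - digit c) := by
  cases a <;> cases c <;> norm_num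

theorem digit_mul_digit_sub_le (a c : Bool) : digit a * (digit a - digit c) ≤ 2 := by
  cases a <;> cases c <;> norm_num

theorem digit_sub_eq_of_ne {a c : Bool} (h : c ≠ a) : digit a - digit c = 2 * digit a := by
  cases a <;> cases c <;> simp_all <;> norm_num

theorem eq_of_digit_sub_eq_zero {a c : Bool} (h : digit a - digit c = 0) : c = a := by
  by_contra hne
  rw [digit_sub_eq_of_ne hne] at h
  cases a <;> norm_num at h

theorem hasSum_of_hasSum_smul {g : ℕ → ℝ} {w : E} (hw : w ≠ 0)
    (h : HasSum (fun n => g n • w) 0) : HasSum g 0 := by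
  obtain ⟨φ, -, hφ⟩ := exists_dual_vector ℝ w (norm_ne_zero_iff.2 hw)
  have h1 := (h.mapL φ).mul_right (‖w‖)⁻¹
  simp only [map_smul, hφ, smul_eq_mul, map_zero, zero_mul] at h1
  have hn : ‖w‖ ≠ 0 := norm_ne_zero_iff.2 hw
  simpa [mul_assoc, hn] using h1

theorem pow_apply_comm (f g : E →L[ℝ] E) (hfg : Commute f g) (n : ℕ) (v : E) :
    (f ^ n) (g v) = g ((f ^ n) v) := by
  rw [← mul_apply_eq_comp, (hfg.pow_left n).eq, mul_apply_eq_comp]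

theorem pow_apply_eigenvector {f : E →L[ℝ] E} {w : E} {l : ℝ} (h : f w = l • w) (n : ℕ) :
    (f ^ n) w = l ^ n • w := by
  induction n with
  | zero => simp
  | succ n ih => rw [pow_succ', mul_apply_eq_comp, ih, map_smul, h, smul_smul, pow_succ]

variable {f : E →L[ℝ] E} {u : E}

/-- A relation between the vectors `f ^ n u` is inherited by the powers of an eigenvalue of `f` on
the orbit of `u`. -/
theorem hasSum_pow_eigenvalue {l m : ℝ} (hcay : f (f u) = (l + m) • f u - (l * m) • u)
    (hm : f u ≠ m • u) {e : ℕ → ℝ} (he : HasSum (fun n => e n • (f ^ n) u) 0) :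
    HasSum (fun n => e n * l ^ n) 0 := by
  -- The factor $f-m$ of the characteristic polynomial sends $u$ to a non-zero eigenvector for $l$,
  -- and it commutes with the powers of $f$.
  set g : E →L[ℝ] E := f - m • ContinuousLinearMap.id ℝ E with hg
  have hgv : ∀ v, g v = f v - m • v := fun v => by simp [hg]
  have hw : f (g u) = l • g u := by
    rw [hgv, map_sub, map_smul, hcay]
    module
  have hcomm : Commute f g := by
    ext v
    simp [hg, mul_apply_eq_comp]
  have h1 := he.mapL g
  simp only [map_smul, ← pow_apply_comm f g hcomm, pow_apply_eigenvector hw, map_zero,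
    smul_smul] at h1
  exact hasSum_of_hasSum_smul (by rw [hgv]; exact sub_ne_zero.2 hm) h1

/-- For a double eigenvalue, $f^nu=l^nu+nl^{n-1}(fu-lu)$. The relation in powers of $l$ removes the
first summand, leaving its formal derivative, which replaces the missing second eigenvalue. At $n=0$
the truncated exponent is harmless because of the factor $n$. -/
theorem hasSum_mul_pow_of_double_eigenvalue {l : ℝ}
    (hcay : f (f u) = (l + l) • f u - (l * l) • u) (hl : f u ≠ l • u) {e : ℕ → ℝ}
    (he : HasSum (fun n => e n • (f ^ n) u) 0) :
    HasSum (fun n => e n * (n * l ^ (n - 1))) 0 := by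
  have h0 := hasSum_pow_eigenvalue hcay hl he
  have hp : ∀ n : ℕ, (f ^ n) u = l ^ n • u + ((n : ℝ) * l ^ (n - 1)) • (f u - l • u) := by
    intro n
    induction n with
    | zero => simp
    | succ n ih =>
      rw [pow_succ', mul_apply_eq_comp, ih]
      simp only [map_add, map_smul, map_sub, hcay]
      cases n with
      | zero => simp
      | succ k =>
        simp only [Nat.add_sub_cancel]
        push_cast
        module
  have h1 := he.sub (h0.smul_const u)
  refine hasSum_of_hasSum_smul (w := f u - l • u) (sub_ne_zero.2 hl) ?_
  convert h1 using 2 with n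
  · rw [hp]; module
  · simp

variable [CompleteSpace E]

theorem hasSum_digit_sub (hs : Summable fun n => ‖(f ^ n) u‖) {a c : ℕ → Bool}
    (h : coding f u c = coding f u a) :
    HasSum (fun n => (digit (a n) - digit (c n)) • (f ^ n) u) 0 := by
  have := (summable_coding hs a).hasSum.sub (summable_coding hs c).hasSum
  rw [show ∑' n, digit (a n) • (f ^ n) u = coding f u a from rfl, ← h, coding, sub_self] at this
  simpa only [sub_smul] using this

/-- A dominating positive eigenvalue, simple or double: sequences with isolated symbols `false` give
unique codings. -/
theorem dimH_uniqueCodings_pos_of_dominating (hs : Summable fun n => ‖(f ^ n) u‖) {κ : ℝ}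
    (hκ : 0 < κ) (hfκ : ∀ v, κ * ‖v‖ ≤ ‖f v‖) {l m : ℝ} (hl : 0 < l) (hl1 : l < 1)
    (hlm : |m| < l ∨ m = l) (hcay : f (f u) = (l + m) • f u - (l * m) • u)
    (hul : f u ≠ l • u) (hum : f u ≠ m • u) : 0 < dimH (uniqueCodings f u) := by
  refine dimH_uniqueCodings_pos hs hκ hfκ
    (K := {a | ∀ i j, a i = false → a j = false → i = j}) ?_ ?_ ?_ ?_
  · simp only [Set.ofPred_forall]
    refine isClosed_iInter fun i => isClosed_iInter fun j => ?_
    have : Continuous fun a : ℕ → Bool => (a i, a j) := by fun_prop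
    exact (isClosed_discrete {q : Bool × Bool | q.1 = false → q.2 = false → i = j}).preimage this
  · intro a ha i j hi hj
    have := ha _ _ hi hj
    omega
  · intro a ha c hc0 hca
    have he := hasSum_digit_sub hs hca
    have h1 := hasSum_pow_eigenvalue hcay hum he
    -- With a leading plus, only the single minus sign at some $j>0$ can contribute negatively, by
    -- at least $-2l^j>-2$, which cannot cancel the leading $2$.
    by_cases ha0 : a 0 = true
    · have hge : ∀ n, a n = true → 0 ≤ (digit (a n) - digit (c n)) * l ^ n := fun n hn =>
        mul_nonneg (digit_sub_nonneg hn) (by positivity)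
      have he0 := digit_sub_eq_of_ne hc0
      rw [ha0, digit_true] at he0
      by_cases hex : ∃ j, a j = false
      · obtain ⟨j, hj⟩ := hex
        have hj0 : j ≠ 0 := by rintro rfl; simp [ha0] at hj
        have h2 := sum_le_hasSum {0, j} (fun n hn => hge n ?_) h1
        · rw [Finset.sum_pair hj0.symm, ha0, digit_true, he0, hj, digit_false, pow_zero] at h2
          have h3 : l ^ j < 1 := pow_lt_one₀ hl.le hl1 hj0
          have h4 : 0 < l ^ j := by positivity
          cases hcj : c j <;> simp only [hcj, digit_true, digit_false] at h2 <;> nlinarith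
        · by_contra hn'
          have := ha n j (by simpa using hn') hj
          simp [this] at hn
      · have hall : ∀ n, a n = true := by simpa using hex
        have h2 := congrFun ((hasSum_zero_iff_of_nonneg fun n => hge n (hall n)).1 h1) 0
        simp only [ha0, digit_true, he0, pow_zero, Pi.zero_apply] at h2
        norm_num at h2
    -- With a leading minus, all later differences are non-negative. A second relation, with weights
    -- $l^n-m^n$ or $nl^{n-1}$, vanishes at $n=0$ and is positive afterwards, so these differences
    -- are all zero.
    · have ha0' : a 0 = false := by simpa using ha0
      have hge : ∀ n, n ≠ 0 → 0 ≤ digit (a n) - digit (c n) := fun n hn =>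
        digit_sub_nonneg (by
          by_contra hn'
          exact hn (ha n 0 (by simpa using hn') ha0'))
      have hzero : ∀ n, n ≠ 0 → digit (a n) - digit (c n) = 0 := by
        rcases hlm with hlm | rfl
        · have hcay' : f (f u) = (m + l) • f u - (m * l) • u := by rw [hcay, add_comm, mul_comm]
          have h2 := h1.sub (hasSum_pow_eigenvalue hcay' hul he)
          rw [sub_self] at h2
          have hpos : ∀ n, n ≠ 0 → 0 < l ^ n - m ^ n := fun n hn => by
            have h3 : |m| ^ n < l ^ n := pow_lt_pow_left₀ hlm (abs_nonneg m) hn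
            rw [← abs_pow] at h3
            linarith [le_abs_self (m ^ n)]
          simp only [← mul_sub] at h2
          intro n hn
          have h3 := congrFun ((hasSum_zero_iff_of_nonneg fun n => ?_).1 h2) n
          · exact (mul_eq_zero.1 h3).resolve_right (hpos n hn).ne'
          · rcases eq_or_ne n 0 with rfl | hn
            · simp
            · exact mul_nonneg (hge n hn) (hpos n hn).le
        · have h2 := hasSum_mul_pow_of_double_eigenvalue hcay hul he
          intro n hn
          have h3 := congrFun ((hasSum_zero_iff_of_nonneg fun n => ?_).1 h2) n
          · refine (mul_eq_zero.1 h3).resolve_right (mul_ne_zero ?_ (by positivity))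
            exact_mod_cast hn
          · rcases eq_or_ne n 0 with rfl | hn
            · simp
            · exact mul_nonneg (hge n hn) (by positivity)
      have h3 := h1.unique (hasSum_single 0 fun n hn => by rw [hzero n hn, zero_mul])
      rw [digit_sub_eq_of_ne hc0, ha0'] at h3
      norm_num at h3
  · intro N
    -- The optional minus sign sits at the last place of a block, so the first `N` symbols of the
    -- next block contain none.
    refine ⟨N + 1, by omega, by omega, fun b i => !(b && decide (i = N)), ⟨N, by omega, by simp⟩,
      fun b b' => ⟨fun i => !(b && decide (i = N)), fun i j hi hj => ?_, fun i hi => ?_⟩⟩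
    · simp at hi hj
      omega
    · split_ifs with h
      · rfl
      · simp [show i ≠ N by omega, show i - (N + 1) ≠ N by omega]

end

/-! ### Combinatorics of the Thue–Morse sequence -/

theorem thueMorse_zero : thueMorse 0 = 0 := thueMorse_substitution.1

theorem thueMorse_two_mul (n : ℕ) : thueMorse (2 * n) = thueMorse n :=
  (thueMorse_substitution.2 n).1

theorem thueMorse_two_mul_add_one (n : ℕ) : thueMorse (2 * n + 1) = 1 - thueMorse n :=
  (thueMorse_substitution.2 n).2

theorem thueMorse_lt_two (n : ℕ) : thueMorse n < 2 := Nat.mod_lt _ (by norm_num)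

/-- Iterating the substitution cuts the sequence into dyadic blocks, each a copy or the complement
of the initial one. These two blocks are the freely concatenable words used later. -/
theorem thueMorse_block (j l : ℕ) {m : ℕ} (hm : m < 2 ^ j) :
    thueMorse (m + 2 ^ j * l) = if thueMorse l = 0 then thueMorse m else 1 - thueMorse m := by
  have hb := thueMorse_lt_two
  induction j generalizing m with
  | zero =>
    obtain rfl : m = 0 := by omega
    have := hb l
    simp only [pow_zero, one_mul, zero_add, thueMorse_zero]
    split_ifs <;> omega
  | succ j ih =>
    have h := hb (m / 2)
    have ih' := ih (m := m / 2) (by rw [pow_succ] at hm; omega)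
    rcases Nat.even_or_odd' m with ⟨i, rfl | rfl⟩
    · rw [show 2 * i + 2 ^ (j + 1) * l = 2 * (i + 2 ^ j * l) by ring, thueMorse_two_mul,
        thueMorse_two_mul, ← ih (by rw [pow_succ] at hm; omega)]
    · rw [show 2 * i + 1 + 2 ^ (j + 1) * l = 2 * (i + 2 ^ j * l) + 1 by ring,
        thueMorse_two_mul_add_one, thueMorse_two_mul_add_one,
        ih (m := i) (by rw [pow_succ] at hm; omega)]
      split_ifs <;> rfl

/-- All pairs of symbols occur consecutively in the Thue–Morse sequence. -/
theorem exists_thueMorse_pair (b b' : Bool) :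
    ∃ l, decide (thueMorse l = 0) = b ∧ decide (thueMorse (l + 1) = 0) = b' := by
  cases b <;> cases b'
  · exact ⟨1, by simp [thueMorse]⟩
  · exact ⟨2, by simp [thueMorse]⟩
  · exact ⟨0, by simp [thueMorse]⟩
  · exact ⟨5, by simp [thueMorse]⟩

/-- Whether the Thue–Morse symbols at `n` and `n + k` differ. -/
def thueMorseDiff (n k : ℕ) : ℕ := if thueMorse (n + k) = thueMorse n then 0 else 1

/-- The Thue–Morse sequence is lexicographically maximal among its normalised shifts. -/
theorem thueMorse_eq_one_of_first_disagreement (m n : ℕ)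
    (h : ∀ k < m, thueMorseDiff n k = thueMorse k) (hm : thueMorseDiff n m ≠ thueMorse m) :
    thueMorse m = 1 := by
  have hb := thueMorse_lt_two
  induction m using Nat.strong_induction_on generalizing n with
  | _ m ih =>
  have t0 := thueMorse_zero
  have hm0 : m ≠ 0 := by
    rintro rfl
    exact hm (by simp [thueMorseDiff, t0])
  rcases Nat.even_or_odd' n with ⟨i, rfl | rfl⟩
  · have heven : ∀ k, thueMorseDiff (2 * i) (2 * k) = thueMorseDiff i k := fun k => by
      rw [thueMorseDiff, ← mul_add, thueMorse_two_mul, thueMorse_two_mul, thueMorseDiff]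
    rcases Nat.even_or_odd' m with ⟨j, rfl | rfl⟩
    · rw [thueMorse_two_mul]
      refine ih j (by omega) i (fun k hk => ?_) ?_
      · rw [← heven, h _ (by omega), thueMorse_two_mul]
      · rwa [← heven, ← thueMorse_two_mul j]
    -- Agreement at the even index $m-1$ forces agreement at $m$, since both symbols in each pair
    -- are complementary.
    · exfalso
      have h1 := h (2 * j) (by omega)
      rw [heven, thueMorse_two_mul, thueMorseDiff] at h1
      apply hm
      rw [thueMorseDiff, ← add_assoc, ← mul_add, thueMorse_two_mul_add_one, thueMorse_two_mul,
        thueMorse_two_mul_add_one, ← h1]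
      have := hb i
      have := hb (i + j)
      split_ifs at * <;> omega
  · have t1 : thueMorse 1 = 1 := by simp [thueMorse]
    have t2 : thueMorse 2 = 1 := by simp [thueMorse]
    rcases Nat.lt_or_ge m 3 with h3 | h3
    · interval_cases m
      · exact absurd rfl hm0
      · exact t1
      · exact t2
    -- Agreement at $1$ and $2$ would make the symbols at $2i+2$ and $2i+3$ both differ from the one
    -- at $2i+1$, yet they are complementary to each other.
    · exfalso
      have h1 := h 1 (by omega)
      have h2 := h 2 (by omega)
      rw [thueMorseDiff, t1, show 2 * i + 1 + 1 = 2 * (i + 1) by ring, thueMorse_two_mul,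
        thueMorse_two_mul_add_one] at h1
      rw [thueMorseDiff, t2, show 2 * i + 1 + 2 = 2 * (i + 1) + 1 by ring,
        thueMorse_two_mul_add_one, thueMorse_two_mul_add_one] at h2
      have := hb i
      have := hb (i + 1)
      split_ifs at h1 h2
      omega

/-! ### Thue–Morse series below the reciprocal Komornik–Loreti constant -/

theorem summable_mul_geometric_of_le_one {q : ℝ} (hq : 0 < q) (hq1 : q < 1) {g : ℕ → ℝ}
    (h0 : ∀ n, 0 ≤ g n) (h1 : ∀ n, g n ≤ 1) : Summable fun n => g n * q ^ n := by
  refine Summable.of_nonneg_of_le (fun n => mul_nonneg (h0 n) (by positivity)) (fun n => ?_)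
    (summable_geometric_of_lt_one hq.le hq1)
  have : 0 < q ^ n := by positivity
  nlinarith [h1 n]

theorem tsum_thueMorse_lt_one {q : ℝ} (hq : 0 < q) (hqK : q < komornikLoreti⁻¹) :
    ∑' n, (thueMorse n : ℝ) * q ^ n < 1 := by
  obtain ⟨h1, h2, -⟩ := komornikLoreti_spec
  have hK : 0 < komornikLoreti := by linarith
  rw [← h2.tsum_eq]
  have hq1 : q < 1 := hqK.trans (inv_lt_one_of_one_lt₀ h1)
  refine Summable.tsum_lt_tsum (i := 1) (fun n => ?_) ?_
    (summable_mul_geometric_of_le_one hq hq1 (fun n => by positivity) thueMorse_le_one) h2.summable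
  · gcongr
  · simpa [thueMorse] using hqK

theorem thueMorseDiff_cast_le_one (n k : ℕ) : (thueMorseDiff n k : ℝ) ≤ 1 := by
  rw [thueMorseDiff]; split_ifs <;> norm_num

/-- Below the reciprocal of the Komornik–Loreti constant, every normalised shift of the
Thue–Morse sequence has a value at most that of the sequence itself. -/
theorem tsum_thueMorseDiff_le {q : ℝ} (hq : 0 < q) (hqK : q < komornikLoreti⁻¹) (n : ℕ) :
    ∑' k, (thueMorseDiff n k : ℝ) * q ^ k ≤ ∑' k, (thueMorse k : ℝ) * q ^ k := by
  have hq1 : q < 1 := hqK.trans (inv_lt_one_of_one_lt₀ komornikLoreti_spec.1)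
  have hS := tsum_thueMorse_lt_one hq hqK
  set S := ∑' k, (thueMorse k : ℝ) * q ^ k with hSdef
  set V : ℕ → ℝ := fun n => ∑' k, (thueMorseDiff n k : ℝ) * q ^ k with hV
  have hsT : Summable fun k => (thueMorse k : ℝ) * q ^ k :=
    summable_mul_geometric_of_le_one hq hq1 (fun n => by positivity) thueMorse_le_one
  have hsV : ∀ n, Summable fun k => (thueMorseDiff n k : ℝ) * q ^ k := fun n =>
    summable_mul_geometric_of_le_one hq hq1 (fun n => by positivity) (thueMorseDiff_cast_le_one n)
  have hbdd : BddAbove (Set.range V) := by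
    refine ⟨∑' k, q ^ k, ?_⟩
    rintro _ ⟨n, rfl⟩
    refine Summable.tsum_le_tsum (fun k => ?_) (hsV n) (summable_geometric_of_lt_one hq.le hq1)
    exact mul_le_of_le_one_left (by positivity) (thueMorseDiff_cast_le_one n k)
  -- At the first disagreement $m$ the Thue–Morse symbol is $1$ and that of the shift is $0$. Thus a
  -- term $q^m$ is lost, while the remaining tail is again a normalised shift because the symbols at
  -- $n$ and $n+m$ coincide.
  have step : ∀ n, V n ≤ S ∨ ∃ m, m ≠ 0 ∧ V n ≤ S + q ^ m * (V (n + m) - 1) := by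
    intro n
    by_cases hall : ∀ k, thueMorseDiff n k = thueMorse k
    · left
      simp only [hV, hSdef, hall, le_refl]
    · right
      classical
      push Not at hall
      set m := Nat.find hall with hm
      have hlt : ∀ k < m, thueMorseDiff n k = thueMorse k := fun k hk =>
        not_not.1 (Nat.find_min hall hk)
      have hne : thueMorseDiff n m ≠ thueMorse m := Nat.find_spec hall
      have htm := thueMorse_eq_one_of_first_disagreement m n hlt hne
      have heq : thueMorse (n + m) = thueMorse n := by
        by_contra h
        exact hne (by rw [thueMorseDiff, if_neg h, htm])
      refine ⟨m, ?_, ?_⟩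
      · intro h0
        rw [h0, thueMorse_zero] at htm
        omega
      · have e1 : V n = ∑ k ∈ Finset.range m, (thueMorse k : ℝ) * q ^ k + q ^ m * V (n + m) := by
          simp only [hV]
          rw [← (hsV n).sum_add_tsum_nat_add m, ← tsum_mul_left]
          congr 1
          · exact Finset.sum_congr rfl fun k hk => by rw [hlt k (Finset.mem_range.1 hk)]
          · refine tsum_congr fun k => ?_
            rw [thueMorseDiff, thueMorseDiff, heq, add_comm k m, add_assoc, pow_add]
            ring
        have e2 : ∑ k ∈ Finset.range m, (thueMorse k : ℝ) * q ^ k + q ^ m ≤ S := by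
          have := hsT.sum_le_tsum (Finset.range (m + 1)) fun k _ => by positivity
          rwa [Finset.sum_range_succ, htm, Nat.cast_one, one_mul] at this
        rw [e1]
        linarith
  have hsup : ∀ n, V n ≤ ⨆ n, V n := le_ciSup hbdd
  -- A supremum $s>1$ would satisfy $s\le S+q(s-1)$, which is impossible as $S<1$. Once $s\le1$, the
  -- correction term in `step` is non-positive.
  have hle1 : ⨆ n, V n ≤ 1 := by
    by_contra! hgt
    have : ⨆ n, V n ≤ S + q * ((⨆ n, V n) - 1) := by
      refine ciSup_le fun n => ?_
      rcases step n with h | ⟨m, hm, h⟩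
      · nlinarith
      · refine h.trans (add_le_add le_rfl ?_)
        calc q ^ m * (V (n + m) - 1) ≤ q ^ m * ((⨆ n, V n) - 1) := by gcongr; exact hsup _
          _ ≤ q * ((⨆ n, V n) - 1) := by
            refine mul_le_mul_of_nonneg_right (pow_le_of_le_one hq.le hq1.le hm) (by linarith)
    nlinarith
  rcases step n with h | ⟨m, hm, h⟩
  · exact h
  · have h1 := (hsup (n + m)).trans hle1
    have h2 : 0 < q ^ m := by positivity
    change V n ≤ S
    nlinarith

/-! ### Sign sequences of functionals and recurrent maps -/

section

variable {E : Type*} [NormedAddCommGroup E] [NormedSpace ℝ E]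

/-- The sequences that code points where some nonzero functional is maximal. -/
def signSequences (f : E →L[ℝ] E) (u : E) : Set (ℕ → Bool) :=
  {a | ∃ φ : E →L[ℝ] ℝ, ‖φ‖ = 1 ∧ ∀ n, 0 ≤ digit (a n) * φ ((f ^ n) u)}

variable {f : E →L[ℝ] E} {u : E}

theorem digit_decide_nonneg_mul (x : ℝ) : 0 ≤ digit (decide (0 ≤ x)) * x := by
  by_cases h : 0 ≤ x
  · simp [h]
  · simp [h]; linarith

/-- This is the projection of a closed set along the unit sphere of the dual, which is compact in
finite dimension; the normalisation of $\varphi$ is made for this purpose. -/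
theorem isClosed_signSequences [FiniteDimensional ℝ E] : IsClosed (signSequences f u) := by
  have : ProperSpace (E →L[ℝ] ℝ) := FiniteDimensional.proper ℝ _
  have hcl : IsClosed {p : (ℕ → Bool) × (E →L[ℝ] ℝ) |
      ∀ n, 0 ≤ digit (p.1 n) * p.2 ((f ^ n) u)} := by
    simp only [Set.ofPred_forall]
    refine isClosed_iInter fun n => isClosed_le continuous_const ?_
    exact ((continuous_digit_apply n).comp continuous_fst).mul
      (continuous_snd.clm_apply continuous_const)
  have hcomp := ((isCompact_univ (X := ℕ → Bool)).prod
    (isCompact_sphere (0 : E →L[ℝ] ℝ) 1)).inter_right hcl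
  convert (hcomp.image continuous_fst).isClosed using 1
  ext a
  constructor
  · rintro ⟨φ, h1, h2⟩
    exact ⟨(a, φ), ⟨⟨trivial, by simpa using h1⟩, h2⟩, rfl⟩
  · rintro ⟨⟨b, φ⟩, ⟨⟨-, h1⟩, h2⟩, rfl⟩
    exact ⟨φ, by simpa using h1, h2⟩

theorem shift_mem_signSequences (hf : Function.Surjective f) {a : ℕ → Bool}
    (ha : a ∈ signSequences f u) : (fun n => a (n + 1)) ∈ signSequences f u := by
  obtain ⟨φ, h1, h2⟩ := ha
  have hne : ‖φ ∘L f‖ ≠ 0 := by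
    rw [norm_ne_zero_iff]
    intro h0
    have : φ = 0 := by
      ext v
      obtain ⟨w, rfl⟩ := hf v
      exact DFunLike.congr_fun h0 w
    rw [this, norm_zero] at h1
    exact zero_ne_one h1
  refine ⟨‖φ ∘L f‖⁻¹ • φ ∘L f, by rw [norm_smul, norm_inv, norm_norm, inv_mul_cancel₀ hne],
    fun n => ?_⟩
  have h3 := h2 (n + 1)
  rw [pow_succ', mul_apply_eq_comp] at h3
  have h4 := mul_nonneg (inv_nonneg.2 (norm_nonneg (φ ∘L f))) h3
  calc (0 : ℝ) ≤ _ := h4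
    _ = _ := by
      rw [smul_apply, ContinuousLinearMap.comp_apply, smul_eq_mul]
      ring

/-- Since `a` maximises $\varphi$ term by term, applying $\varphi$ to the difference of the codings
gives a vanishing sum of non-negative terms. Another coding can therefore deviate only where
$\varphi(f^nu)=0$. -/
theorem digit_sub_mul_eq_zero_of_coding_eq [CompleteSpace E]
    (hs : Summable fun n => ‖(f ^ n) u‖) {φ : E →L[ℝ] ℝ} {a c : ℕ → Bool}
    (ha : ∀ n, 0 ≤ digit (a n) * φ ((f ^ n) u)) (hca : coding f u c = coding f u a) (n : ℕ) :
    (digit (a n) - digit (c n)) * φ ((f ^ n) u) = 0 := by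
  have h := (hasSum_digit_sub hs hca).mapL φ
  simp only [map_smul, smul_eq_mul, map_zero] at h
  refine congrFun ((hasSum_zero_iff_of_nonneg fun n => ?_).1 h) n
  have h1 := mul_nonneg (digit_mul_digit_sub_nonneg (a n) (c n)) (ha n)
  have h2 := digit_mul_self (a n)
  calc (0 : ℝ) ≤ _ := h1
    _ = (digit (a n) * digit (a n)) * ((digit (a n) - digit (c n)) * φ ((f ^ n) u)) := by ring
    _ = _ := by rw [h2, one_mul]

theorem eq_smul_of_apply_eq_zero (hE : Module.finrank ℝ E = 2) {φ : E →L[ℝ] ℝ} (hφ : φ ≠ 0) {v w : E} (hv : v ≠ 0)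
    (hφv : φ v = 0) (hφw : φ w = 0) : ∃ τ : ℝ, w = τ • v := by
  have : FiniteDimensional ℝ E := FiniteDimensional.of_finrank_eq_succ hE
  have h1 := Module.Dual.finrank_ker_add_one_of_ne_zero (K := ℝ) (V₁ := E)
    (f := (φ : E →ₗ[ℝ] ℝ)) (by exact_mod_cast hφ)
  have h2 : Module.finrank ℝ (LinearMap.ker (φ : E →ₗ[ℝ] ℝ)) = 1 := by omega
  have h3 := (finrank_eq_one_iff_of_nonzero' (⟨v, hφv⟩ : LinearMap.ker (φ : E →ₗ[ℝ] ℝ))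
    (by simpa [Subtype.ext_iff] using hv)).1 h2 ⟨w, hφw⟩
  obtain ⟨τ, hτ⟩ := h3
  exact ⟨τ, (congrArg Subtype.val hτ).symm⟩

theorem exists_norm_one_apply_eq_zero (hE : Module.finrank ℝ E = 2) (v : E) : ∃ φ : E →L[ℝ] ℝ, ‖φ‖ = 1 ∧ φ v = 0 := by
  have : FiniteDimensional ℝ E := FiniteDimensional.of_finrank_eq_succ hE
  have hlt : Submodule.span ℝ {v} < ⊤ := by
    refine lt_top_iff_ne_top.2 fun h => ?_
    have h1 := finrank_span_le_card (R := ℝ) {v}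
    rw [h, finrank_top, hE] at h1
    simp at h1
  obtain ⟨ψ, hψ, hle⟩ := Submodule.exists_le_ker_of_lt_top _ hlt
  set φ := LinearMap.toContinuousLinearMap ψ with hφ
  have hne : ‖φ‖ ≠ 0 := by
    rw [norm_ne_zero_iff]
    intro h0
    exact hψ ((LinearEquiv.map_eq_zero_iff _).1 h0)
  refine ⟨‖φ‖⁻¹ • φ, by rw [norm_smul, norm_inv, norm_norm, inv_mul_cancel₀ hne], ?_⟩
  have : ψ v = 0 := hle (Submodule.mem_span_singleton_self v)
  simp [hφ, this]

theorem injective_of_bounded_below {κ : ℝ} (hκ : 0 < κ) (hfκ : ∀ v, κ * ‖v‖ ≤ ‖f v‖) :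
    Function.Injective f := by
  refine (injective_iff_map_eq_zero f).2 fun v hv => ?_
  have := hfκ v
  rw [hv, norm_zero] at this
  by_contra hne
  have : 0 < κ * ‖v‖ := mul_pos hκ (norm_pos_iff.2 hne)
  linarith

/-- If no vector of the orbit of `u` returns to the line of `u`, and suitable multiples of the
powers of `f` accumulate at the identity, then there are many unique codings. -/
theorem dimH_uniqueCodings_pos_of_recurrent (hE : Module.finrank ℝ E = 2)
    (hs : Summable fun n => ‖(f ^ n) u‖) {κ : ℝ} (hκ : 0 < κ) (hfκ : ∀ v, κ * ‖v‖ ≤ ‖f v‖) (hu : u ≠ 0)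
    (hline : ∀ n ≠ 0, ∀ τ : ℝ, (f ^ n) u ≠ τ • u) {c : ℝ} (hc : 0 < c)
    (hrec : MapClusterPt (1 : E →L[ℝ] E) atTop fun k : ℕ => (c • f) ^ k) :
    0 < dimH (uniqueCodings f u) := by
  have : FiniteDimensional ℝ E := FiniteDimensional.of_finrank_eq_succ hE
  have : CompleteSpace E := FiniteDimensional.complete ℝ E
  have hinj := injective_of_bounded_below hκ hfκ
  have hpinj : ∀ n, Function.Injective (f ^ n : E →L[ℝ] E) := fun n => by
    induction n with
    | zero => exact fun _ _ h => h
    | succ n ih =>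
      intro v w h
      rw [pow_succ, mul_apply_eq_comp, mul_apply_eq_comp] at h
      exact hinj (ih h)
  have hsurj : Function.Surjective f := LinearMap.surjective_of_injective (f := (f : E →ₗ[ℝ] E)) hinj
  have hzero : ∀ φ : E →L[ℝ] ℝ, φ ≠ 0 → ∀ i j, i < j → φ ((f ^ i) u) = 0 →
      φ ((f ^ j) u) ≠ 0 := by
    intro φ hφ i j hij hi hj
    have hne : (f ^ i) u ≠ 0 := fun h => hu (hpinj i (by rw [h, map_zero]))
    obtain ⟨τ, hτ⟩ := eq_smul_of_apply_eq_zero hE hφ hne hi hj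
    refine hline (j - i) (by omega) τ (hpinj i ?_)
    rw [map_smul, ← hτ, ← mul_apply_eq_comp, ← pow_add]
    congr 2
    omega
  refine dimH_uniqueCodings_pos hs hκ hfκ (K := signSequences f u) isClosed_signSequences
    (fun a => shift_mem_signSequences hsurj) ?_ ?_
  · rintro a ⟨φ, hφ1, hφ⟩ c hc0 hca
    have hφ0 : φ ≠ 0 := by
      rintro rfl
      simp at hφ1
    have h1 := digit_sub_mul_eq_zero_of_coding_eq hs hφ hca
    have he0 : digit (a 0) - digit (c 0) ≠ 0 := fun h => hc0 (eq_of_digit_sub_eq_zero h)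
    have h2 : φ ((f ^ 0) u) = 0 := (mul_eq_zero.1 (h1 0)).resolve_left he0
    have h3 := hasSum_digit_sub hs hca
    have h4 := h3.unique (hasSum_single 0 fun n hn => by
      rw [(mul_eq_zero.1 (h1 n)).resolve_right (hzero φ hφ0 0 n (Nat.pos_of_ne_zero hn) h2),
        zero_smul])
    exact (smul_ne_zero he0 hu) (by simpa using h4.symm)
  · intro N
    -- Killing $f^Nu$ makes the sign at `N` free. A recurrence time $k>N$ at which the signs at
    -- indices below `N` reappear serves as block length.
    obtain ⟨φ, hφ1, hφN⟩ := exists_norm_one_apply_eq_zero hE ((f ^ N) u)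
    have hφ0 : φ ≠ 0 := by
      rintro rfl
      simp at hφ1
    have hnbhd : ∀ᶠ g : E →L[ℝ] E in 𝓝 1, ∀ i ∈ Finset.range N,
        0 < φ ((f ^ i) u) * φ (g ((f ^ i) u)) := by
      rw [Filter.eventually_all_finset]
      intro i hi
      have hcont : Continuous fun g : E →L[ℝ] E => φ ((f ^ i) u) * φ (g ((f ^ i) u)) := by
        fun_prop
      refine hcont.continuousAt.eventually (lt_mem_nhds ?_)
      exact mul_self_pos.2 fun h => hzero φ hφ0 i N (Finset.mem_range.1 hi) h hφN
    obtain ⟨k, hk, hkN⟩ := ((hrec.frequently hnbhd).and_eventually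
      (eventually_ge_atTop (N + 1))).exists
    have hsame : ∀ i < N, decide (0 ≤ φ ((f ^ (i + k)) u)) = decide (0 ≤ φ ((f ^ i) u)) := by
      intro i hi
      have h1 := hk i (Finset.mem_range.2 hi)
      rw [smul_pow, smul_apply, ← mul_apply_eq_comp, ← pow_add, add_comm k i,
        map_smul, smul_eq_mul] at h1
      have h2 : 0 < c ^ k := by positivity
      rw [decide_eq_decide]
      constructor
      · intro h
        by_contra! h'
        nlinarith [mul_nonneg h2.le h]
      · intro h
        by_contra! h'
        nlinarith [mul_pos h2 (neg_pos.2 h')]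
    refine ⟨k, by omega, by omega,
      fun b i => if i = N then b else decide (0 ≤ φ ((f ^ i) u)), ⟨N, by omega, by simp⟩,
      fun b b' => ⟨fun i => if i = N then b else decide (0 ≤ φ ((f ^ i) u)),
        ⟨φ, hφ1, fun n => ?_⟩, fun i hi => ?_⟩⟩
    · by_cases hn : n = N
      · rw [hn, hφN, mul_zero]
      · simp only [if_neg hn]
        exact digit_decide_nonneg_mul _
    · split_ifs with h
      · rfl
      · have := hsame (i - k) (by omega)
        rw [Nat.sub_add_cancel (by omega)] at this
        simp only [if_neg (show i ≠ N by omega), if_neg (show i - k ≠ N by omega), this]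

end

/-! ### Powers that are homotheties -/

section

/-- Flip the symbol `b` when `τ ^ m` is negative. -/
noncomputable def twist (τ : ℝ) (m : ℕ) (b : Bool) : Bool :=
  open Classical in if τ < 0 ∧ Odd m then !b else b

/-- Twisting absorbs the sign of $\tau$, so correlations may be computed as if the ratio were
$|\tau|$. -/
theorem digit_twist_mul (τ : ℝ) (m k : ℕ) (b b' : Bool) :
    digit (twist τ m b) * digit (twist τ (m + k) b') * τ ^ k = digit b * digit b' * |τ| ^ k := by
  have h : ∀ m b, digit (twist τ m b) = (if τ < 0 then (-1 : ℝ) else 1) ^ m * digit b := by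
    intro m b
    by_cases h1 : τ < 0
    · rcases Nat.even_or_odd m with h2 | h2
      · simp [twist, h1, Nat.not_odd_iff_even.2 h2, h2.neg_one_pow]
      · simp [twist, h2, h1, h2.neg_one_pow]
    · simp [twist, h1]
  have hs : (if τ < 0 then (-1 : ℝ) else 1) ^ 2 = 1 := by split_ifs <;> norm_num
  have hτ : τ = (if τ < 0 then (-1 : ℝ) else 1) * |τ| := by
    split_ifs with h1
    · rw [abs_of_neg h1]; ring
    · rw [abs_of_nonneg (not_lt.1 h1)]; ring
  set s := if τ < 0 then (-1 : ℝ) else 1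
  have hτk : τ ^ k = s ^ k * |τ| ^ k := by rw [← mul_pow, ← hτ]
  rw [h, h, hτk]
  calc s ^ m * digit b * (s ^ (m + k) * digit b') * (s ^ k * |τ| ^ k)
      = (s ^ 2) ^ (m + k) * (digit b * digit b' * |τ| ^ k) := by ring
    _ = _ := by rw [hs, one_pow, one_mul]

theorem digit_decide_mul_digit_decide {x c : ℝ} (hx : x ≠ 0) (hc : c ≠ 0) :
    digit (decide (0 ≤ x)) * digit (decide (0 ≤ c * x)) * c = |c| := by
  rcases hx.lt_or_gt with hx | hx <;> rcases hc.lt_or_gt with hc | hc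
  · simp [hx.not_ge, (mul_pos_of_neg_of_neg hc hx).le, abs_of_neg hc]
  · simp [hx.not_ge, (mul_neg_of_pos_of_neg hc hx).not_ge, abs_of_pos hc]
  · simp [hx.le, (mul_neg_of_neg_of_pos hc hx).not_ge, abs_of_neg hc]
  · simp [hx.le, (mul_pos hc hx).le, abs_of_pos hc]

theorem digit_thueMorse_mul (n k : ℕ) :
    digit (decide (thueMorse n = 0)) * digit (decide (thueMorse (n + k) = 0)) =
      1 - 2 * thueMorseDiff n k := by
  have h1 := thueMorse_lt_two n
  have h2 := thueMorse_lt_two (n + k)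
  rw [thueMorseDiff]
  interval_cases thueMorse n <;> interval_cases thueMorse (n + k) <;> norm_num

variable {E : Type*} [NormedAddCommGroup E] [NormedSpace ℝ E] {f : E →L[ℝ] E} {u : E}

theorem norm_correlation_le (τ : ℝ) (b b' : Bool) (k : ℕ) :
    ‖|τ| ^ k - digit b * digit b' * τ ^ k‖ ≤ 2 * |τ| ^ k := by
  refine (norm_sub_le _ _).trans ?_
  simp only [norm_mul, norm_pow, Real.norm_eq_abs, abs_digit, abs_abs]
  linarith

theorem summable_two_mul_abs_pow {τ : ℝ} (hτ1 : |τ| < 1) : Summable fun k : ℕ => 2 * |τ| ^ k :=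
  (summable_geometric_of_lt_one (abs_nonneg τ) hτ1).mul_left 2

theorem summable_correlation (Q : ℕ) {τ : ℝ} (hτ1 : |τ| < 1) (a : ℕ → Bool) (n : ℕ) :
    Summable fun k => |τ| ^ k - digit (a n) * digit (a (n + Q * k)) * τ ^ k :=
  Summable.of_norm_bounded (summable_two_mul_abs_pow hτ1) fun k => norm_correlation_le τ _ _ k

/-- The sequences whose subsequences along arithmetic progressions of difference `Q` do not deviate
much from those maximising the expansions in powers of `τ`. -/
def correlatedSequences (Q : ℕ) (τ s : ℝ) : Set (ℕ → Bool) :=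
  {a | ∀ n, ∑' k, (|τ| ^ k - digit (a n) * digit (a (n + Q * k)) * τ ^ k) ≤ s}

theorem isClosed_correlatedSequences (Q : ℕ) {τ : ℝ} (hτ1 : |τ| < 1) (s : ℝ) :
    IsClosed (correlatedSequences Q τ s) := by
  simp only [correlatedSequences, Set.ofPred_forall]
  refine isClosed_iInter fun n => isClosed_le (continuous_tsum (fun k => ?_)
    (summable_two_mul_abs_pow hτ1) fun k a => norm_correlation_le τ _ _ k) continuous_const
  exact continuous_const.sub
    (((continuous_digit_apply n).mul (continuous_digit_apply _)).mul continuous_const)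

theorem shift_mem_correlatedSequences {Q : ℕ} {τ s : ℝ} {a : ℕ → Bool}
    (ha : a ∈ correlatedSequences Q τ s) : (fun n => a (n + 1)) ∈ correlatedSequences Q τ s :=
  fun n => by simpa only [add_right_comm n 1] using ha (n + 1)

theorem pow_mul_apply_of_pow_eq_smul {Q : ℕ} {τ : ℝ} (hfQ : ∀ v, (f ^ Q) v = τ • v) (k : ℕ)
    (v : E) : (f ^ (Q * k)) v = τ ^ k • v := by
  rw [pow_mul]
  exact pow_apply_eigenvector (hfQ v) k

theorem dvd_of_apply_pow_eq_zero (hE : Module.finrank ℝ E = 2) (hu : u ≠ 0) {Q : ℕ}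
    (hline : ∀ n (σ : ℝ), (f ^ n) u = σ • u → Q ∣ n) {φ : E →L[ℝ] ℝ} (hφ1 : ‖φ‖ = 1)
    (hφu : φ u = 0) {n : ℕ} (hn : φ ((f ^ n) u) = 0) : Q ∣ n := by
  have hφ0 : φ ≠ 0 := by
    rintro rfl
    simp at hφ1
  obtain ⟨σ, hσ⟩ := eq_smul_of_apply_eq_zero hE hφ0 hu hφu hn
  exact hline n σ hσ

/-- A second coding deviates only at multiples of `Q`, which gives $\sum_k e_{Qk}\tau^k=0$. Multiply
by the leading sign and add the correlation defect: every term becomes non-negative and the one at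
$k=0$ equals $2$, whereas the total is at most $s<2$. -/
theorem coding_ne_of_mem_correlatedSequences (hE : Module.finrank ℝ E = 2)
    (hs : Summable fun n => ‖(f ^ n) u‖) (hu : u ≠ 0) {Q : ℕ} (hQ : Q ≠ 0) {τ s : ℝ}
    (hτ1 : |τ| < 1) (hs2 : s < 2) (hfQ : ∀ v, (f ^ Q) v = τ • v)
    (hline : ∀ n (σ : ℝ), (f ^ n) u = σ • u → Q ∣ n) {a c : ℕ → Bool}
    (ha : a ∈ signSequences f u) (haC : a ∈ correlatedSequences Q τ s) (hc0 : c 0 ≠ a 0) :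
    coding f u c ≠ coding f u a := by
  intro hca
  have : FiniteDimensional ℝ E := FiniteDimensional.of_finrank_eq_succ hE
  have : CompleteSpace E := FiniteDimensional.complete ℝ E
  have hpow := pow_mul_apply_of_pow_eq_smul hfQ
  obtain ⟨φ, hφ1, hφ⟩ := ha
  have h1 := digit_sub_mul_eq_zero_of_coding_eq hs hφ hca
  have he0 : digit (a 0) - digit (c 0) ≠ 0 := fun h => hc0 (eq_of_digit_sub_eq_zero h)
  have hφu : φ u = 0 := (mul_eq_zero.1 (h1 0)).resolve_left he0
  have hi : Function.Injective fun k => Q * k :=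
    fun i j h => Nat.eq_of_mul_eq_mul_left (Nat.pos_of_ne_zero hQ) h
  have h2 := (hi.hasSum_iff (f := fun n => (digit (a n) - digit (c n)) • (f ^ n) u) (a := 0)
    fun n hn => ?_).2 (hasSum_digit_sub hs hca)
  swap
  · have hn' : φ ((f ^ n) u) ≠ 0 := fun h => by
      obtain ⟨k, hk⟩ := dvd_of_apply_pow_eq_zero hE hu hline hφ1 hφu h
      exact hn ⟨k, hk.symm⟩
    rw [(mul_eq_zero.1 (h1 n)).resolve_right hn', zero_smul]
  simp only [Function.comp_def, hpow, smul_smul] at h2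
  have h3 := (hasSum_of_hasSum_smul hu h2).mul_left (digit (a 0))
  have h4 := haC 0
  simp only [zero_add] at h4
  have h5 := summable_correlation Q hτ1 a 0
  simp only [zero_add] at h5
  have h6 := sum_le_hasSum {0} (fun k _ => ?_) (h3.add h5.hasSum)
  · rw [Finset.sum_singleton, mul_zero, digit_sub_eq_of_ne hc0] at h6
    have := digit_mul_self (a 0)
    simp only [pow_zero] at h6
    nlinarith
  · have hx0 := digit_mul_digit_sub_nonneg (a (Q * k)) (c (Q * k))
    have hx2 := digit_mul_digit_sub_le (a (Q * k)) (c (Q * k))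
    have hd := digit_mul_self (a (Q * k))
    set x := digit (a (Q * k)) * (digit (a (Q * k)) - digit (c (Q * k))) with hx
    have hy : digit (a (Q * k)) - digit (c (Q * k)) = digit (a (Q * k)) * x := by
      rw [hx, ← mul_assoc, hd, one_mul]
    rw [hy]
    have hs1 : |digit (a 0) * digit (a (Q * k)) * τ ^ k| = |τ| ^ k := by
      rw [abs_mul, abs_mul, abs_digit, abs_digit, abs_pow]; ring
    obtain ⟨hs2, hs3⟩ := abs_le.1 hs1.le
    calc (0 : ℝ) ≤ |τ| ^ k + (digit (a 0) * digit (a (Q * k)) * τ ^ k) * (x - 1) := by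
          nlinarith
      _ = _ := by ring

/-- If a power of `f` is a homothety whose ratio is smaller than the reciprocal of the
Komornik–Loreti constant, then there are many unique codings. -/
theorem dimH_uniqueCodings_pos_of_pow_eq_smul (hE : Module.finrank ℝ E = 2)
    (hs : Summable fun n => ‖(f ^ n) u‖) {κ : ℝ} (hκ : 0 < κ) (hfκ : ∀ v, κ * ‖v‖ ≤ ‖f v‖)
    (hu : u ≠ 0) {Q : ℕ} (hQ : Q ≠ 0) {τ : ℝ} (hτ0 : τ ≠ 0) (hτ : |τ| < komornikLoreti⁻¹)
    (hfQ : ∀ v, (f ^ Q) v = τ • v) (hline : ∀ n (σ : ℝ), (f ^ n) u = σ • u → Q ∣ n) :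
    0 < dimH (uniqueCodings f u) := by
  classical
  have : FiniteDimensional ℝ E := FiniteDimensional.of_finrank_eq_succ hE
  have : CompleteSpace E := FiniteDimensional.complete ℝ E
  have hsurj : Function.Surjective f := LinearMap.surjective_of_injective
    (f := (f : E →ₗ[ℝ] E)) (injective_of_bounded_below hκ hfκ)
  have hq : 0 < |τ| := abs_pos.2 hτ0
  have hq1 : |τ| < 1 := hτ.trans (inv_lt_one_of_one_lt₀ komornikLoreti_spec.1)
  have hS := tsum_thueMorse_lt_one hq hτ
  have hTM := tsum_thueMorseDiff_le hq hτ
  set S := ∑' k, (thueMorse k : ℝ) * |τ| ^ k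
  have hpow := pow_mul_apply_of_pow_eq_smul hfQ
  have hpow' : ∀ n k, (f ^ (n + Q * k)) u = τ ^ k • (f ^ n) u := fun n k => by
    rw [add_comm, pow_add, mul_apply_eq_comp, hpow]
  have hdvd : ∀ φ : E →L[ℝ] ℝ, ‖φ‖ = 1 → φ u = 0 → ∀ n, φ ((f ^ n) u) = 0 → Q ∣ n :=
    fun φ hφ1 hφu n hn => dvd_of_apply_pow_eq_zero hE hu hline hφ1 hφu hn
  set C : Set (ℕ → Bool) := correlatedSequences Q τ (2 * S)
  have hshift : ∀ a ∈ signSequences f u ∩ C, (fun n => a (n + 1)) ∈ signSequences f u ∩ C :=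
    fun a ha => ⟨shift_mem_signSequences hsurj ha.1, shift_mem_correlatedSequences ha.2⟩
  refine dimH_uniqueCodings_pos hs hκ hfκ
    (isClosed_signSequences.inter (isClosed_correlatedSequences Q hq1 _)) hshift ?_ ?_
  · rintro a ⟨ha, haC⟩ c hc0
    exact coding_ne_of_mem_correlatedSequences hE hs hu hQ hq1 (by linarith) hfQ hline ha haC hc0
  · intro N
    obtain ⟨φ, hφ1, hφu⟩ := exists_norm_one_apply_eq_zero hE u
    -- The functional vanishes on $f^nu$ exactly for $Q\mid n$. There an arbitrary sequence,
    -- twisted, is inserted; elsewhere the sign is forced and the correlation defect is zero.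
    set seq : (ℕ → Bool) → ℕ → Bool := fun y n =>
      if Q ∣ n then twist τ (n / Q) (y (n / Q)) else decide (0 ≤ φ ((f ^ n) u)) with hseq
    have hseq_mul : ∀ y m, seq y (Q * m) = twist τ m (y m) := fun y m => by
      simp [hseq, Nat.mul_div_cancel_left m (Nat.pos_of_ne_zero hQ)]
    have hseq_of_not : ∀ y n, ¬ Q ∣ n → seq y n = decide (0 ≤ φ ((f ^ n) u)) := fun y n hn => by
      simp only [hseq, if_neg hn]
    set tb : ℕ → Bool := fun m => decide (thueMorse m = 0) with htb
    have hmem : seq tb ∈ signSequences f u ∩ C := by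
      refine ⟨⟨φ, hφ1, fun n => ?_⟩, fun n => ?_⟩
      · by_cases hn : Q ∣ n
        · obtain ⟨m, rfl⟩ := hn
          rw [hpow, map_smul, hφu, smul_zero, mul_zero]
        · rw [hseq_of_not _ _ hn]
          exact digit_decide_nonneg_mul _
      · by_cases hn : Q ∣ n
        · obtain ⟨m, rfl⟩ := hn
          simp only [← mul_add, hseq_mul, digit_twist_mul, htb, digit_thueMorse_mul]
          refine le_trans (le_of_eq ?_) (mul_le_mul_of_nonneg_left (hTM m) zero_le_two)
          rw [← tsum_mul_left]
          exact tsum_congr fun k => by ring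
        · have h0 : ∀ k, |τ| ^ k - digit (seq tb n) * digit (seq tb (n + Q * k)) * τ ^ k = 0 := by
            intro k
            rw [hseq_of_not _ _ hn, hseq_of_not _ _ (by rwa [Nat.dvd_add_left (dvd_mul_right Q k)]),
              hpow', map_smul, smul_eq_mul, digit_decide_mul_digit_decide
                (fun h => hn (hdvd φ hφ1 hφu n h)) (pow_ne_zero k hτ0), abs_pow, sub_self]
          simp only [h0, tsum_zero]
          have : 0 ≤ S := tsum_nonneg fun k => by positivity
          linarith
    -- The exponent `N + 1` makes `B` both at least `N` and even; evenness keeps twists and forced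
    -- signs unchanged when moving by whole blocks.
    set B := 2 ^ (N + 1) with hB
    have hNB : N ≤ B := by
      have : N + 1 < 2 ^ (N + 1) := Nat.lt_two_pow_self
      omega
    have hBe : Even B := ⟨2 ^ N, by rw [hB, pow_succ]; ring⟩
    set y : Bool → ℕ → Bool := fun b m => if b then tb m else !tb m with hy
    have hblock : ∀ l i, i < Q * B → seq tb (i + Q * B * l) = seq (y (tb l)) i := by
      intro l i hi
      by_cases hn : Q ∣ i
      · obtain ⟨m, rfl⟩ := hn
        have hm : m < B := Nat.lt_of_mul_lt_mul_left hi
        rw [mul_assoc, ← mul_add, hseq_mul, hseq_mul]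
        have h1 : tb (m + B * l) = y (tb l) m := by
          have h2 := thueMorse_lt_two m
          change decide (thueMorse (m + B * l) = 0) = if decide (thueMorse l = 0) then
            decide (thueMorse m = 0) else !decide (thueMorse m = 0)
          rw [thueMorse_block (N + 1) l hm]
          by_cases h3 : thueMorse l = 0
          · simp [h3]
          · rw [if_neg h3, decide_eq_false h3]
            interval_cases thueMorse m <;> simp
        have h4 : Odd (m + B * l) ↔ Odd m := by
          rw [Nat.odd_add]
          exact ⟨fun h => h.2 (hBe.mul_right l), fun h => iff_of_true h (hBe.mul_right l)⟩
        rw [h1]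
        simp only [twist, h4]
      · have hd : Q ∣ Q * (B * l) := dvd_mul_right _ _
        rw [mul_assoc, hseq_of_not _ _ hn, hseq_of_not _ _ (by rwa [Nat.dvd_add_left hd]), hpow',
          map_smul, smul_eq_mul, decide_eq_decide]
        have : 0 < τ ^ (B * l) := (hBe.mul_right l).pow_pos hτ0
        exact mul_nonneg_iff_of_pos_left this
    have hB0 : 0 < B := by positivity
    refine ⟨Q * B, by positivity, hNB.trans (Nat.le_mul_of_pos_left B (by omega)),
      fun b => seq (y b), ⟨0, by positivity, ?_⟩, fun b b' => ?_⟩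
    · have h1 := hseq_mul (y true) 0
      have h2 := hseq_mul (y false) 0
      rw [mul_zero] at h1 h2
      simp only [h1, h2]
      simp [twist, hy]
    · obtain ⟨l, rfl, rfl⟩ := exists_thueMorse_pair b b'
      refine ⟨_, add_mem_of_shift_mem hshift (Q * B * l) hmem, fun i hi => ?_⟩
      have hNL : N ≤ Q * B := hNB.trans (Nat.le_mul_of_pos_left B (by omega))
      split_ifs with h
      · exact hblock l i h
      · refine Eq.trans ?_ (hblock (l + 1) (i - Q * B) (by omega))
        congr 1
        rw [mul_add]
        omega

end

/-! ### Powers of a rotation -/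

section Rotation

variable {E : Type*} [NormedAddCommGroup E] [NormedSpace ℝ E]

/-- The Cayley–Hamilton relation is the three-term recurrence of $\sin(n\theta)$. The factor
$\sin\theta$ stays on the left to avoid division. -/
theorem sin_smul_pow_apply {g : E →L[ℝ] E} {θ : ℝ}
    (hg : ∀ v, g (g v) = (2 * Real.cos θ) • g v - v) (n : ℕ) (v : E) :
    Real.sin θ • (g ^ n) v = Real.sin (n * θ) • g v - Real.sin (n * θ - θ) • v := by
  induction n with
  | zero => simp
  | succ n ih =>
    have h1 := congrArg g ih
    rw [map_smul, map_sub, map_smul, map_smul, hg] at h1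
    rw [pow_succ', mul_apply_eq_comp, h1]
    have h2 : Real.sin ((n + 1 : ℕ) * θ) =
        2 * Real.cos θ * Real.sin (n * θ) - Real.sin (n * θ - θ) := by
      push_cast
      rw [add_one_mul, Real.sin_add, Real.sin_sub]
      ring
    have h3 : Real.sin ((n + 1 : ℕ) * θ - θ) = Real.sin (n * θ) := by
      push_cast
      congr 1
      ring
    rw [h2, h3]
    module

/-- The powers of a rotation accumulate at the identity. -/
theorem mapClusterPt_one_pow {g : E →L[ℝ] E} {θ : ℝ}
    (hg : ∀ v, g (g v) = (2 * Real.cos θ) • g v - v) (hθ : Real.sin θ ≠ 0) :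
    MapClusterPt (1 : E →L[ℝ] E) atTop fun k : ℕ => g ^ k := by
  -- This continuous map sends $e^{ik\theta}$ to $g^k$, so recurrence is inherited from the compact
  -- circle group.
  set Ψ : Circle → (E →L[ℝ] E) := fun z => (Real.sin θ)⁻¹ • ((z : ℂ).im • g -
    ((z : ℂ).im * Real.cos θ - (z : ℂ).re * Real.sin θ) • (1 : E →L[ℝ] E)) with hΨ
  have hcont : Continuous Ψ := by
    have h1 : Continuous fun z : Circle => (z : ℂ).im := Complex.continuous_im.comp (by fun_prop)
    have h2 : Continuous fun z : Circle => (z : ℂ).re := Complex.continuous_re.comp (by fun_prop)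
    fun_prop
  have h1 : Ψ 1 = 1 := by
    ext v
    simp [hΨ, hθ]
  have hk : ∀ k : ℕ, Ψ (Circle.exp θ ^ k) = g ^ k := by
    intro k
    have h2 : ((Circle.exp θ ^ k : Circle) : ℂ) = Complex.exp (((k * θ : ℝ) : ℂ) * Complex.I) := by
      rw [Circle.coe_pow, Circle.coe_exp, ← Complex.exp_nat_mul]
      push_cast
      ring_nf
    ext v
    have h3 : Ψ (Circle.exp θ ^ k) v = (Real.sin θ)⁻¹ • (Real.sin θ • (g ^ k) v) := by
      rw [sin_smul_pow_apply hg, Real.sin_sub]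
      simp only [hΨ, h2, Complex.exp_ofReal_mul_I_im, Complex.exp_ofReal_mul_I_re]
      rfl
    rw [h3, inv_smul_smul₀ hθ]
  have h2 := (mapClusterPt_one_atTop_pow (Circle.exp θ)).tendsto_comp hcont.continuousAt.tendsto
  rw [h1] at h2
  exact h2.congrFun (Eventually.of_forall hk)

end Rotation

/-! ### The cases according to the eigenvalues -/

section Plane

variable {E : Type*} [NormedAddCommGroup E] [NormedSpace ℝ E] {f : E →L[ℝ] E} {u : E}

theorem neg_pow_apply (f : E →L[ℝ] E) (n : ℕ) (v : E) :
    ((-f) ^ n) v = (-1 : ℝ) ^ n • (f ^ n) v := by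
  rw [show -f = (-1 : ℝ) • f by simp, smul_pow]
  rfl

/-- Flipping the signs at odd indices turns codings for $-f$ into codings for $f$ bijectively. -/
theorem uniqueCodings_neg_subset (f : E →L[ℝ] E) (u : E) :
    uniqueCodings (-f) u ⊆ uniqueCodings f u := by
  set w : (ℕ → Bool) → ℕ → Bool := fun a n => if Even n then a n else !a n with hw
  have hww : ∀ a, w (w a) = a := fun a => by
    ext n
    by_cases hn : Even n <;> simp [hw, hn]
  have hc : ∀ a, coding f u (w a) = coding (-f) u a := fun a => by
    refine tsum_congr fun n => ?_
    rw [neg_pow_apply]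
    by_cases hn : Even n
    · simp [hw, hn]
    · simp [hw, hn, (Nat.not_even_iff_odd.1 hn).neg_one_pow]
  rintro z ⟨a, ha, huniq⟩
  refine ⟨w a, by rw [hc, ha], fun c h => ?_⟩
  rw [← huniq (w c) (by rw [← hc, hww, h]), hww]

variable {κ t d : ℝ}

theorem dimH_uniqueCodings_pos_of_real_eigenvalues [CompleteSpace E]
    (hs : Summable fun n => ‖(f ^ n) u‖) (hκ : 0 < κ) (hfκ : ∀ v, κ * ‖v‖ ≤ ‖f v‖)
    (hcyc : ∀ m : ℝ, f u ≠ m • u) (hcay : ∀ v, f (f v) = t • f v - d • v) (ht : t ≠ 0)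
    (hdisc : 4 * d ≤ t ^ 2) (hroot : ∀ x : ℝ, x ^ 2 - t * x + d = 0 → |x| < 1) :
    0 < dimH (uniqueCodings f u) := by
  have hr0 := Real.sqrt_nonneg (t ^ 2 - 4 * d)
  have hr2 := Real.sq_sqrt (sub_nonneg.2 hdisc)
  set r := √(t ^ 2 - 4 * d)
  have hdom : ∀ s : ℝ, 0 < s → |(s - r) / 2| < (s + r) / 2 ∨ (s - r) / 2 = (s + r) / 2 := by
    intro s hs
    rcases hr0.eq_or_lt with h | h
    · right; rw [← h]; ring
    · left; rw [abs_lt]; constructor <;> linarith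
  rcases ht.lt_or_gt with ht | ht
  · refine lt_of_lt_of_le ?_ (dimH_mono (uniqueCodings_neg_subset f u))
    have hneg : ∀ m : ℝ, (-f) u ≠ m • u := fun m h => hcyc (-m) (by
      rw [neg_smul, ← h]; simp)
    refine dimH_uniqueCodings_pos_of_dominating (κ := κ) (l := (-t + r) / 2) (m := (-t - r) / 2) ?_ hκ
      ?_ (by linarith) ?_ (hdom (-t) (by linarith)) ?_ (hneg _) (hneg _)
    · simpa only [neg_pow_apply, norm_smul, norm_pow, norm_neg, norm_one, one_pow, one_mul] using hs
    · simpa using hfκ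
    · have := hroot ((t - r) / 2) (by linear_combination hr2 / 4)
      rw [abs_lt] at this
      linarith [this.1]
    · have h1 : (-f) ((-f) u) = t • f u - d • u := by simp [hcay]
      have h2 : (-t + r) / 2 * ((-t - r) / 2) = d := by linear_combination -hr2 / 4
      rw [h1, h2, show (-f) u = -f u from rfl]
      module
  · refine dimH_uniqueCodings_pos_of_dominating hs hκ hfκ (l := (t + r) / 2) (m := (t - r) / 2)
      (by linarith) ?_ (hdom t ht) ?_ (hcyc _) (hcyc _)
    · exact (abs_lt.1 (hroot ((t + r) / 2) (by linear_combination hr2 / 4))).2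
    · have h2 : (t + r) / 2 * ((t - r) / 2) = d := by linear_combination -hr2 / 4
      rw [hcay, h2]
      module

theorem dimH_uniqueCodings_pos_of_opposite_eigenvalues (hE : Module.finrank ℝ E = 2)
    (hs : Summable fun n => ‖(f ^ n) u‖) (hκ : 0 < κ) (hfκ : ∀ v, κ * ‖v‖ ≤ ‖f v‖)
    (hcyc : ∀ m : ℝ, f u ≠ m • u) {l : ℝ} (hl : l ≠ 0) (hf : ∀ v, f (f v) = l ^ 2 • v)
    (hlK : l ^ 2 < komornikLoreti⁻¹) : 0 < dimH (uniqueCodings f u) := by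
  have hf2 : ∀ v, (f ^ 2) v = l ^ 2 • v := fun v => by rw [pow_two, mul_apply_eq_comp, hf]
  refine dimH_uniqueCodings_pos_of_pow_eq_smul hE hs hκ hfκ ?_ two_ne_zero (pow_ne_zero 2 hl)
    (by rwa [abs_of_nonneg (sq_nonneg l)]) hf2 fun n σ hσ => ?_
  · rintro rfl
    exact hcyc 0 (by simp)
  · by_contra hn
    obtain ⟨k, rfl⟩ : Odd n := by rwa [← Nat.not_even_iff_odd, even_iff_two_dvd]
    rw [add_comm, pow_add, pow_one, mul_apply_eq_comp, pow_mul, pow_apply_eigenvector (hf2 u),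
      map_smul] at hσ
    refine hcyc (((l ^ 2) ^ k)⁻¹ * σ) ?_
    rw [mul_smul, ← hσ, inv_smul_smul₀ (by positivity)]

theorem dimH_uniqueCodings_pos_of_rotation (hE : Module.finrank ℝ E = 2)
    (hs : Summable fun n => ‖(f ^ n) u‖) (hκ : 0 < κ) (hfκ : ∀ v, κ * ‖v‖ ≤ ‖f v‖)
    (hcyc : ∀ m : ℝ, f u ≠ m • u) {ρ θ : ℝ} (hρ : 0 < ρ) (hρ1 : ρ < 1) (hθ : Real.sin θ ≠ 0)
    (hcay : ∀ v, f (f v) = (2 * ρ * Real.cos θ) • f v - ρ ^ 2 • v)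
    (hrat : ∀ (p : ℤ) (q : ℕ), 0 < q → IsCoprime p (q : ℤ) → θ = 2 * Real.pi * p / q →
      ρ ^ (if Odd q then q else q / 2) < komornikLoreti⁻¹) :
    0 < dimH (uniqueCodings f u) := by
  classical
  have hu : u ≠ 0 := by
    rintro rfl
    exact hcyc 0 (by simp)
  set g : E →L[ℝ] E := ρ⁻¹ • f with hg
  have hgv : ∀ v, g v = ρ⁻¹ • f v := fun v => rfl
  have hfg : ∀ n v, (f ^ n) v = ρ ^ n • (g ^ n) v := fun n v => by
    rw [hg, smul_pow, smul_apply, smul_smul, ← mul_pow, mul_inv_cancel₀ hρ.ne', one_pow, one_smul]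
  have hgg : ∀ v, g (g v) = (2 * Real.cos θ) • g v - v := fun v => by
    rw [hgv, hgv, map_smul, hcay, smul_smul, smul_sub, smul_smul, smul_smul, smul_smul]
    congr 1
    · congr 1
      field_simp
    · rw [show ρ⁻¹ * ρ⁻¹ * ρ ^ 2 = 1 by field_simp, one_smul]
  by_cases hex : ∃ n, n ≠ 0 ∧ ∃ σ : ℝ, (f ^ n) u = σ • u
  -- The first return of $u$ to its own line forces $\sin(Q\theta)=0$, so the whole map $f^Q$ is
  -- $\pm\rho^Q$ times the identity. Minimality of `Q` makes all return times multiples of it.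
  · set Q := Nat.find hex with hQdef
    obtain ⟨hQ, σ, hσ⟩ : Q ≠ 0 ∧ ∃ σ : ℝ, (f ^ Q) u = σ • u := Nat.find_spec hex
    have hsin : Real.sin (Q * θ) = 0 := by
      by_contra hne
      have h1 := sin_smul_pow_apply hgg Q u
      rw [hfg] at hσ
      have h2 : (g ^ Q) u = ((ρ ^ Q)⁻¹ * σ) • u := by
        rw [mul_smul, ← hσ, inv_smul_smul₀ (by positivity)]
      rw [h2, hgv, eq_sub_iff_add_eq, smul_smul, smul_smul, ← add_smul] at h1
      refine hcyc ((Real.sin (Q * θ) * ρ⁻¹)⁻¹ *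
        (Real.sin θ * ((ρ ^ Q)⁻¹ * σ) + Real.sin (Q * θ - θ))) ?_
      rw [mul_smul, h1, inv_smul_smul₀ (mul_ne_zero hne (inv_ne_zero hρ.ne'))]
    have hcos : |Real.cos (Q * θ)| = 1 := by
      have h1 := Real.sin_sq_add_cos_sq (Q * θ)
      rw [hsin] at h1
      rw [← sq_eq_sq₀ (abs_nonneg _) zero_le_one, sq_abs]
      linarith
    have hfQ : ∀ v, (f ^ Q) v = (ρ ^ Q * Real.cos (Q * θ)) • v := by
      intro v
      have h1 := sin_smul_pow_apply hgg Q v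
      rw [hsin, zero_smul, zero_sub, ← neg_smul, Real.sin_sub, hsin] at h1
      have h2 : (g ^ Q) v = Real.cos (Q * θ) • v := by
        rw [← inv_smul_smul₀ hθ ((g ^ Q) v), h1, smul_smul]
        congr 1
        field_simp
        ring
      rw [hfg, h2, smul_smul]
    have hτ : |ρ ^ Q * Real.cos (Q * θ)| = ρ ^ Q := by
      rw [abs_mul, hcos, mul_one, abs_of_pos (by positivity)]
    have hτ0 : ρ ^ Q * Real.cos (Q * θ) ≠ 0 := abs_ne_zero.1 (by rw [hτ]; positivity)
    refine dimH_uniqueCodings_pos_of_pow_eq_smul hE hs hκ hfκ hu hQ hτ0 ?_ hfQ ?_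
    · rw [hτ]
      obtain ⟨p', hp'⟩ := Real.sin_eq_zero_iff.1 hsin
      -- From $Q\theta=p'\pi$ one gets $\theta=2\pi p'/(2Q)$. The reduced denominator $q$ divides
      -- $2Q$, whence $q\le Q$ for odd $q$ and $q/2\le Q$ for even $q$, that is,
      -- $\rho^Q\le\rho^{q'}$.
      set x : ℚ := Rat.divInt p' (2 * Q : ℕ) with hx
      have hxden : (x.den : ℤ) ∣ (2 * Q : ℕ) := Rat.den_dvd _ _
      have hden : x.den ∣ 2 * Q := by exact_mod_cast hxden
      have hQ0 : (Q : ℝ) ≠ 0 := by exact_mod_cast hQ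
      have hθx : θ = 2 * Real.pi * x.num / x.den := by
        have h1 : (x : ℝ) = x.num / x.den := Rat.cast_def x
        have h2 : (x : ℝ) = p' / (2 * Q : ℕ) := by
          rw [hx, Rat.divInt_eq_div]
          push_cast
          ring
        rw [mul_div_assoc, ← h1, h2]
        push_cast
        field_simp
        linarith
      have h1 := hrat x.num x.den x.pos
        (by rw [Int.isCoprime_iff_gcd_eq_one]; exact x.reduced) hθx
      refine lt_of_le_of_lt (pow_le_pow_of_le_one hρ.le hρ1.le ?_) h1
      have h2 := Nat.le_of_dvd (by omega) hden
      split_ifs with hodd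
      · exact Nat.le_of_dvd (by omega)
          ((Nat.Coprime.dvd_mul_left (Nat.coprime_two_right.2 hodd)).1 hden)
      · omega
    · intro n σ' hn
      by_contra hdvd
      have hlt := Nat.mod_lt n (Nat.pos_of_ne_zero hQ)
      refine Nat.find_min hex hlt ⟨fun h => hdvd (Nat.dvd_of_mod_eq_zero h), ?_⟩
      rw [← Nat.mod_add_div n Q, pow_add, (Commute.pow_pow_self f _ _).eq,
        mul_apply_eq_comp, pow_mul, pow_apply_eigenvector (hfQ _)] at hn
      refine ⟨((ρ ^ Q * Real.cos (Q * θ)) ^ (n / Q))⁻¹ * σ', ?_⟩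
      rw [mul_smul, ← hn, inv_smul_smul₀ (pow_ne_zero _ hτ0)]
  · push Not at hex
    exact dimH_uniqueCodings_pos_of_recurrent hE hs hκ hfκ hu hex (inv_pos.2 hρ)
      (mapClusterPt_one_pow hgg hθ)

end Plane

/-! ### From matrices and addresses to linear maps and codings -/

section

/-- By Gelfand's formula the norms of the powers are eventually below $r^n$, for any $r$ strictly
between the spectral radius and $1$. -/
theorem summable_norm_pow_of_spectrum_lt {A : Type*} [NormedRing A] [NormedAlgebra ℂ A]
    [CompleteSpace A] [Nontrivial A] (a : A) (h : ∀ z ∈ spectrum ℂ a, ‖z‖ < 1) :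
    Summable fun n => ‖a ^ n‖ := by
  have h1 : spectralRadius ℂ a < ((1 : NNReal) : ENNReal) :=
    spectrum.spectralRadius_lt_of_forall_lt a fun z hz => h z hz
  obtain ⟨r, hr1, hr2⟩ := ENNReal.lt_iff_exists_nnreal_btwn.1 h1
  have hr : (r : ℝ) < 1 := by exact_mod_cast hr2
  refine Summable.of_norm_bounded_eventually_nat (summable_geometric_of_lt_one r.2 hr) ?_
  filter_upwards [(spectrum.pow_nnnorm_pow_one_div_tendsto_nhds_spectralRadius a).eventually
    (gt_mem_nhds hr1), eventually_gt_atTop 0] with n hn hn0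
  have h2 := hn.le
  rw [one_div, ENNReal.rpow_inv_le_iff (by exact_mod_cast hn0), ENNReal.rpow_natCast] at h2
  have h3 : ‖a ^ n‖₊ ≤ r ^ n := by exact_mod_cast h2
  rw [norm_norm]
  exact_mod_cast h3

/-- The continuous linear map of the plane given by a matrix. -/
noncomputable def planeMap (M : Matrix (Fin 2) (Fin 2) ℝ) : Plane →L[ℝ] Plane :=
  Matrix.toEuclideanCLM (𝕜 := ℝ) M

variable {M : Matrix (Fin 2) (Fin 2) ℝ} {u : Plane} {A : Set Plane}

theorem planeMap_apply (v : Plane) : planeMap M v = Matrix.toEuclideanLin M v := rfl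

theorem planeMap_pow_apply (n : ℕ) (v : Plane) :
    (planeMap M ^ n) v = Matrix.toEuclideanLin (M ^ n) v := by
  rw [planeMap, ← map_pow]
  rfl

/-- Complexification preserves norms, so bounds from the complex spectrum apply to the real matrix.
-/
theorem norm_toEuclideanLin_eq (M : Matrix (Fin 2) (Fin 2) ℝ) (v : Plane) :
    ‖Matrix.toEuclideanLin M v‖ = ‖Matrix.toEuclideanCLM (𝕜 := ℂ) (M.map (algebraMap ℝ ℂ))
      (WithLp.toLp 2 fun i => (v i : ℂ))‖ := by
  have h : ∀ i, ‖(M.map (algebraMap ℝ ℂ)).mulVec (fun i => (v i : ℂ)) i‖ =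
      ‖Matrix.toEuclideanLin M v i‖ := fun i => by
    rw [← Complex.norm_real]
    congr 1
    fin_cases i <;> simp [Matrix.toLpLin_apply, Matrix.mulVec, dotProduct]
  rw [EuclideanSpace.norm_eq, EuclideanSpace.norm_eq]
  simp only [Matrix.toEuclideanCLM_toLp, h]

theorem summable_norm_planeMap_pow (hM : ∀ κ ∈ eigenvalues M, ‖κ‖ < 1) (v : Plane) :
    Summable fun n => ‖(planeMap M ^ n) v‖ := by
  have h := summable_norm_pow_of_spectrum_lt
    (Matrix.toEuclideanCLM (n := Fin 2) (𝕜 := ℂ) (M.map (algebraMap ℝ ℂ)))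
    (fun z hz => hM z (by rwa [AlgEquiv.spectrum_eq] at hz))
  refine Summable.of_nonneg_of_le (fun n => norm_nonneg _) (fun n => ?_)
    (h.mul_right ‖(WithLp.toLp 2 fun i => (v i : ℂ) : EuclideanSpace ℂ (Fin 2))‖)
  rw [planeMap_pow_apply, norm_toEuclideanLin_eq, ← map_pow]
  have hmap : (M ^ n).map (algebraMap ℝ ℂ) = M.map (algebraMap ℝ ℂ) ^ n :=
    map_pow (algebraMap ℝ ℂ).mapMatrix M n
  rw [hmap]
  exact ContinuousLinearMap.le_opNorm _ _

theorem mem_eigenvalues_iff (z : ℂ) :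
    z ∈ eigenvalues M ↔ z ^ 2 - (M.trace : ℂ) * z + (M.det : ℂ) = 0 := by
  rw [eigenvalues, Matrix.mem_spectrum_iff_isRoot_charpoly, Matrix.charpoly_fin_two,
    Polynomial.IsRoot.def]
  simp [Matrix.trace_fin_two, Matrix.det_fin_two]

theorem planeMap_planeMap (v : Plane) :
    planeMap M (planeMap M v) = M.trace • planeMap M v - M.det • v := by
  have h : M * M = M.trace • M - M.det • (1 : Matrix (Fin 2) (Fin 2) ℝ) := by
    ext i j
    fin_cases i <;> fin_cases j <;>
      simp [Matrix.mul_apply, Fin.sum_univ_two, Matrix.trace_fin_two, Matrix.det_fin_two] <;> ring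
  rw [← mul_apply_eq_comp, planeMap, ← map_mul, h, map_sub, map_smul, map_smul, map_one]
  rfl

theorem prefixMap_eq (a : ℕ → Bool) (n : ℕ) (v : Plane) :
    prefixMap M u a n v =
      ∑ i ∈ Finset.range n, digit (a i) • (planeMap M ^ i) u + (planeMap M ^ n) v := by
  induction n generalizing v with
  | zero => simp [prefixMap]
  | succ n ih =>
    have hT : T M u (a n) v = planeMap M v + digit (a n) • u := by
      rw [T, planeMap_apply]
      cases a n <;> simp
    rw [prefixMap, Function.comp_apply, ih, hT, map_add, map_smul, Finset.sum_range_succ, pow_succ,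
      mul_apply_eq_comp]
    abel

theorem tendsto_prefixMap (hM : ∀ κ ∈ eigenvalues M, ‖κ‖ < 1) (a : ℕ → Bool) (v : Plane) :
    Tendsto (fun n => prefixMap M u a n v) atTop (𝓝 (coding (planeMap M) u a)) := by
  simp only [prefixMap_eq]
  have h1 := (summable_coding (summable_norm_planeMap_pow hM u) a).hasSum.tendsto_sum_nat
  have h2 := (summable_norm_planeMap_pow hM v).tendsto_atTop_zero
  have h3 := h1.add (tendsto_zero_iff_norm_tendsto_zero.2 h2)
  rwa [add_zero] at h3

theorem isAddress_iff (hM : ∀ κ ∈ eigenvalues M, ‖κ‖ < 1) (a : ℕ → Bool) (z : Plane) :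
    IsAddress M u a z ↔ coding (planeMap M) u a = z := by
  have h := (tendsto_prefixMap (u := u) hM a 0).comp (tendsto_add_atTop_nat 1)
  exact ⟨fun h' => tendsto_nhds_unique h h', fun h' => h' ▸ h⟩

theorem coding_mem_attractor (hM : ∀ κ ∈ eigenvalues M, ‖κ‖ < 1) (hA : IsAttractor M u A)
    (a : ℕ → Bool) : coding (planeMap M) u a ∈ A := by
  obtain ⟨⟨z, hz⟩, hcomp, heq⟩ := hA
  have hT : ∀ b, ∀ v ∈ A, T M u b v ∈ A := by
    intro b v hv
    rw [heq]
    cases b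
    · exact Or.inl ⟨v, hv, rfl⟩
    · exact Or.inr ⟨v, hv, rfl⟩
  have hpre : ∀ n, ∀ v ∈ A, prefixMap M u a n v ∈ A := by
    intro n
    induction n with
    | zero => exact fun v hv => hv
    | succ n ih => exact fun v hv => ih _ (hT _ v hv)
  exact hcomp.isClosed.mem_of_tendsto (tendsto_prefixMap hM a z)
    (Eventually.of_forall fun n => hpre n z hz)

theorem uniqueCodings_subset_uniquenessSet (hM : ∀ κ ∈ eigenvalues M, ‖κ‖ < 1)
    (hA : IsAttractor M u A) : uniqueCodings (planeMap M) u ⊆ uniquenessSet M u A := by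
  rintro z ⟨a, rfl, ha⟩
  exact ⟨coding_mem_attractor hM hA a, a, (isAddress_iff hM a _).2 rfl,
    fun c hc => ha c ((isAddress_iff hM c _).1 hc)⟩

theorem planeMap_ne_smul_of_nonDegenerate (hnd : NonDegenerate M u) (m : ℝ) :
    planeMap M u ≠ m • u := by
  intro h
  have hle : Submodule.span ℝ (Set.range fun n : ℕ => Matrix.toEuclideanLin (M ^ n) u) ≤
      Submodule.span ℝ {u} := by
    rw [Submodule.span_le]
    rintro _ ⟨n, rfl⟩
    change Matrix.toEuclideanLin (M ^ n) u ∈ _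
    rw [← planeMap_pow_apply, pow_apply_eigenvector h]
    exact Submodule.smul_mem _ _ (Submodule.mem_span_singleton_self u)
  rw [hnd.2, top_le_iff] at hle
  have h1 := finrank_span_le_card (R := ℝ) {u}
  rw [hle, finrank_top] at h1
  simp at h1

theorem dimH_uniqueCodings_planeMap_pos (hM : ∀ κ ∈ eigenvalues M, ‖κ‖ < 1)
    (hnd : NonDegenerate M u) (hrot : ¬ ExceptionalRotation M) (hrefl : ¬ ExceptionalReflection M) :
    0 < dimH (uniqueCodings (planeMap M) u) := by
  have hE : Module.finrank ℝ Plane = 2 := by simp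
  have hs := summable_norm_planeMap_pow hM u
  have hcyc := planeMap_ne_smul_of_nonDegenerate hnd
  have hcay := planeMap_planeMap (M := M)
  have hK : 0 < komornikLoreti := by linarith [komornikLoreti_spec.1]
  have hd : M.det ≠ 0 := fun h => hnd.1 ((mem_eigenvalues_iff 0).2 (by simp [h]))
  have hker : LinearMap.ker (planeMap M : Plane →ₗ[ℝ] Plane) = ⊥ := by
    rw [LinearMap.ker_eq_bot']
    intro v hv
    have h1 := hcay v
    rw [show planeMap M v = 0 from hv, map_zero, smul_zero, zero_sub, eq_comm, neg_eq_zero] at h1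
    exact (smul_eq_zero.1 h1).resolve_left hd
  -- Injectivity in finite dimension gives an expansion bound, which supplies the constant
  -- $\kappa=1/C$.
  obtain ⟨C, hC, hanti⟩ := LinearMap.exists_antilipschitzWith _ hker
  have hC' : (0 : ℝ) < C := hC
  have hκ : (0 : ℝ) < (C : ℝ)⁻¹ := inv_pos.2 hC'
  have hfκ : ∀ v, (C : ℝ)⁻¹ * ‖v‖ ≤ ‖planeMap M v‖ := fun v => by
    have h1 := hanti.le_mul_dist v 0
    rw [map_zero, dist_zero_right, dist_zero_right] at h1
    rw [inv_mul_le_iff₀ hC']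
    exact h1
  rcases le_or_gt (4 * M.det) (M.trace ^ 2) with hdisc | hdisc
  · have hroot : ∀ x : ℝ, x ^ 2 - M.trace * x + M.det = 0 → |x| < 1 := fun x hx => by
      have h1 := hM x ((mem_eigenvalues_iff _).2 (by exact_mod_cast hx))
      rwa [Complex.norm_real, Real.norm_eq_abs] at h1
    by_cases ht : M.trace = 0
    · have hdneg : M.det < 0 := lt_of_le_of_ne (by rw [ht] at hdisc; linarith) hd
      have hl := Real.sqrt_pos.2 (neg_pos.2 hdneg)
      have hl2 := Real.sq_sqrt (neg_pos.2 hdneg).le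
      have hl2' : ((√(-M.det) : ℝ) : ℂ) ^ 2 = -(M.det : ℂ) := by exact_mod_cast hl2
      refine dimH_uniqueCodings_pos_of_opposite_eigenvalues hE hs hκ hfκ hcyc hl.ne' ?_ ?_
      · intro v
        rw [hcay, ht, hl2]
        module
      · by_contra! hge
        refine hrefl ⟨√(-M.det), hl, ?_, ?_, ?_⟩
        · rw [mem_eigenvalues_iff, ht, hl2']; simp
        · rw [mem_eigenvalues_iff, ht, neg_sq, hl2']; simp
        · exact inv_le_of_inv_le₀ hK hge
    · exact dimH_uniqueCodings_pos_of_real_eigenvalues hs hκ hfκ hcyc hcay ht hdisc hroot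
  · have hdpos : 0 < M.det := by nlinarith [sq_nonneg M.trace]
    set ρ := √M.det with hρdef
    have hρ : 0 < ρ := Real.sqrt_pos.2 hdpos
    have hρ2 : ρ ^ 2 = M.det := Real.sq_sqrt hdpos.le
    have habs : |M.trace / (2 * ρ)| < 1 := by
      rw [← sq_lt_one_iff_abs_lt_one, div_pow, div_lt_one (by positivity), mul_pow, hρ2]
      linarith
    obtain ⟨hlo, hhi⟩ := abs_lt.1 habs
    set θ := Real.arccos (M.trace / (2 * ρ)) with hθdef
    have hcos : M.trace = 2 * ρ * Real.cos θ := by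
      rw [hθdef, Real.cos_arccos hlo.le hhi.le]
      field_simp
    have hsin : Real.sin θ ≠ 0 := by
      have h1 : (M.trace / (2 * ρ)) ^ 2 < 1 := (sq_lt_one_iff_abs_lt_one _).2 habs
      rw [hθdef, Real.sin_arccos]
      exact (Real.sqrt_pos.2 (by linarith)).ne'
    -- With $\rho=\sqrt{\det M}$ and $2\rho\cos\theta=\operatorname{tr}M$, this is a non-real
    -- eigenvalue. It gives $\rho<1$, and for rational angles it is the witness in the exceptional
    -- case.
    set z : ℂ := ρ * Complex.exp (θ * Complex.I) with hz
    have hzeq : z = ρ * (Real.cos θ + Real.sin θ * Complex.I) := by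
      rw [hz, Complex.exp_mul_I, Complex.ofReal_cos, Complex.ofReal_sin]
    have hzmem : z ∈ eigenvalues M := by
      have h1 : ((Real.cos θ : ℝ) : ℂ) ^ 2 + ((Real.sin θ : ℝ) : ℂ) ^ 2 = 1 := by
        exact_mod_cast Real.cos_sq_add_sin_sq θ
      rw [mem_eigenvalues_iff, hcos, ← hρ2, hzeq]
      push_cast only [Complex.ofReal_mul, Complex.ofReal_pow, Complex.ofReal_ofNat]
      linear_combination (ρ : ℂ) ^ 2 * (-h1) + (ρ : ℂ) ^ 2 * (Real.sin θ : ℂ) ^ 2 * Complex.I_sq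
    have hρ1 : ρ < 1 := by
      have h1 := hM z hzmem
      rwa [hz, norm_mul, Complex.norm_exp_ofReal_mul_I, mul_one, Complex.norm_real,
        Real.norm_of_nonneg hρ.le] at h1
    refine dimH_uniqueCodings_pos_of_rotation hE hs hκ hfκ hcyc hρ hρ1 hsin ?_ ?_
    · intro v
      rw [hcay, ← hcos, hρ2]
    · intro p q hq hpq hθ
      by_contra! hge
      refine hrot ⟨z, ρ, p, q, hzmem, ?_, hρ, hq, hpq, ?_, inv_le_of_inv_le₀ hK hge⟩
      · rw [hz, Complex.im_ofReal_mul, Complex.exp_ofReal_mul_I_im]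
        exact mul_ne_zero hρ.ne' hsin
      · rw [hz, hθ]
        push_cast
        ring_nf

end

end PlanarIFS


theorem theorem1p4 (M : Matrix (Fin 2) (Fin 2) ℝ) (u : PlanarIFS.Plane) (A : Set PlanarIFS.Plane)
    (hM : ∀ κ ∈ PlanarIFS.eigenvalues M, ‖κ‖ < 1)
    (hnd : PlanarIFS.NonDegenerate M u)
    (hrot : ¬ PlanarIFS.ExceptionalRotation M)
    (hrefl : ¬ PlanarIFS.ExceptionalReflection M)
    (hA : PlanarIFS.IsAttractor M u A) :
    ¬ (PlanarIFS.uniquenessSet M u A).Countable ∧ 0 < dimH (PlanarIFS.uniquenessSet M u A) := by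
  have h : 0 < dimH (PlanarIFS.uniquenessSet M u A) :=
    (PlanarIFS.dimH_uniqueCodings_planeMap_pos hM hnd hrot hrefl).trans_le
      (dimH_mono (PlanarIFS.uniqueCodings_subset_uniquenessSet hM hA))
  exact ⟨fun hc => h.ne' (dimH_countable hc), h⟩
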